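/- **Setting.** Let $M$ be an open subset of $\mathbb R^{\iota}$ (product topology; in the main case $\iota=\mathbb N$, a finite or any other index set is allowed) with coordinates $h^i$ $(i\in\iota)$. For an open $V\subset M$ let $\mathcal F(V)$ be the ring of real functions $f$ on $V$ that are smooth functions of finitely many coordinates, i.e. $f=g\circ\pi$ with $\pi$ the projection to finitely many coordinates and $g$ of class $C^\infty$ on $\pi(V)$. Let $\Phi(V)$ be the $\mathcal F(V)$-module of 1-forms $\sum f_i\,dh^i$ (finite sums) and $\mathcal T(V)$ the $\mathcal F(V)$-module of vector fields $\sum z^i\partial/\partial h^i$ (arbitrary, possibly infinite families $z^i\in\mathcal F(V)$), with the pairing $\varphi(Z)=\sum f_iz^i$ and the Lie derivative $\mathcal L_Z=Z\rfloor d+d\,Z\rfloor$. For a submodule $\Omega\subset\Phi(V)$ put $\mathcal H=\Omega^\perp=\{Z\in\mathcal T(V):\omega(Z)=0\text{ for all }\omega\in\Omega\}$, and for $\Theta\subset\Phi(V)$ let $\mathcal L_{\mathcal H}\Theta$ be the submodule generated by all $\mathcal L_Z\vartheta$, $Z\in\mathcal H$, $\vartheta\in\Theta$. "Finite-dimensional"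 means: having a finite basis. A *good filtration* of $\Omega$ is a sequence $\Omega_0\subset\Omega_1\subset\cdots$ of finite-dimensional submodules with $\bigcup_l\Omega_l=\Omega$, $\mathcal L_{\mathcal H}\Omega_l\subset\Omega_{l+1}$ for all $l$, and $\Omega_l+\mathcal L_{\mathcal H}\Omega_l=\Omega_{l+1}$ for all large $l$. A *diffiety* is a submodule $\Omega$ with $\Phi(V)/\Omega$ finite-dimensional that has a good filtration. The *$c$-lift* $\Omega_{*+c}$ is the filtration $\Omega_c\subset\Omega_{c+1}\subset\cdots$. The graded module $\mathcal M=\bigoplus_{l\ge0}\mathcal M_l$, $\mathcal M_l=\Omega_l/\Omega_{l-1}$ (with $\Omega_{-1}=0$), carries the multiplications $Z:\mathcal M_l\to\mathcal M_{l+1}$, $Z[\omega]=[\mathcal L_Z\omega]$ $(Z\in\mathcal H)$, and so is a module over the polynomial algebra $\mathcal A=\mathcal F(V)\oplus\mathcal H\oplus(\mathcal H\odot\mathcal H)\oplus\cdots$. For a basis $Z_1,\dots,Z_n$ of $\mathcal H$ let $\mathcal A(i)\subset\mathcal A$ be the ideal generated by $Z_1,\dots,Z_i$, and $\mathcal M(i)=\mathcal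 M/\mathcal A(i)\mathcal M=\bigoplus_l\mathcal M(i)_l$. The basis is *quasiregular* if $Z_{i+1}:\mathcal M(i)_l\to\mathcal M(i)_{l+1}$ is injective for all $0\le i\le n-1$ and all $l\ge1$. A good filtration is *involutive* if $\mathcal H$ has a quasiregular basis and $\Omega_l+\mathcal L_{\mathcal H}\Omega_l=\Omega_{l+1}$ for all $l\ge0$. For open $U\subset M$ the restriction $\Theta|_U$ of a submodule $\Theta\subset\Phi(M)$ is the $\mathcal F(U)$-submodule of $\Phi(U)$ generated by the restrictions to $U$ of the elements of $\Theta$. **Theorem.** Let $\Omega\subset\Phi(M)$ be a diffiety and $\Omega_*$ a good filtration of $\Omega$ such that every $\mathcal F(M)$-module $\mathcal M_l=\Omega_l/\Omega_{l-1}$ $(l\ge0)$ has a basis. Then every point $P\in M$ has an open neighbourhood $U\subset M$ and a number $c_0$ such that for all $c\ge c_0$ the $c$-lift $(\Omega_{*}|_U)_{*+c}$ of the restricted filtration is an involutive good filtration of $\Omega|_U$. -/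

import Mathlib

noncomputable section

namespace Diffiety

open TopologicalSpace

/-! ### The structural ring, differential forms and vector fields on an open set of `ℝ^ι` -/

variable {ι : Type*}

/-- The function `f` on the open set `V` is a smooth function of the finitely many coordinates
with indices in `s`. -/
def DependsSmoothlyOn (V : Opens (ι → ℝ)) (s : Finset ι) (f : V → ℝ) : Prop :=
  ∃ g : (s → ℝ) → ℝ, ContDiffOn ℝ (⊤ : ℕ∞) g (s.restrict '' (V : Set (ι → ℝ))) ∧
    ∀ x : V, f x = g (s.restrict (x : ι → ℝ))

theorem DependsSmoothlyOn.mono {V : Opens (ι → ℝ)} {s t : Finset ι} (hst : s ⊆ t) {f : V → ℝ}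
    (hf : DependsSmoothlyOn V s f) : DependsSmoothlyOn V t f := by
  obtain ⟨g, hg, hfg⟩ := hf
  refine ⟨fun y => g (Finset.restrict₂ (π := fun _ => ℝ) hst y), ?_, fun x => hfg x⟩
  refine hg.comp (t := s.restrict '' (V : Set (ι → ℝ))) ?_ ?_
  · refine ContDiff.contDiffOn ?_
    rw [contDiff_pi]
    intro i
    exact contDiff_apply ℝ ℝ (⟨i.1, hst i.2⟩ : t)
  · rintro _ ⟨x, hx, rfl⟩
    exact ⟨x, hx, rfl⟩

/-- The structural ring `𝓕(V)`: real functions on `V` which are smooth functions of finitely many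
coordinates. -/
def functionRing (V : Opens (ι → ℝ)) : Subalgebra ℝ (V → ℝ) where
  carrier := {f | ∃ s : Finset ι, DependsSmoothlyOn V s f}
  mul_mem' := by
    classical
    rintro f₁ f₂ ⟨s₁, h₁⟩ ⟨s₂, h₂⟩
    obtain ⟨g₁, hg₁, e₁⟩ := h₁.mono (Finset.subset_union_left (s₂ := s₂))
    obtain ⟨g₂, hg₂, e₂⟩ := h₂.mono (Finset.subset_union_right (s₁ := s₁))
    exact ⟨s₁ ∪ s₂, fun y => g₁ y * g₂ y, hg₁.mul hg₂, fun x => by simp [e₁, e₂]⟩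
  add_mem' := by
    classical
    rintro f₁ f₂ ⟨s₁, h₁⟩ ⟨s₂, h₂⟩
    obtain ⟨g₁, hg₁, e₁⟩ := h₁.mono (Finset.subset_union_left (s₂ := s₂))
    obtain ⟨g₂, hg₂, e₂⟩ := h₂.mono (Finset.subset_union_right (s₁ := s₁))
    exact ⟨s₁ ∪ s₂, fun y => g₁ y + g₂ y, hg₁.add hg₂, fun x => by simp [e₁, e₂]⟩
  algebraMap_mem' := fun r => ⟨∅, fun _ => r, contDiffOn_const, fun _ => rfl⟩

/-- `𝓕(V)` as a type. -/
def Fn (V : Opens (ι → ℝ)) : Type _ := functionRing V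

instance (V : Opens (ι → ℝ)) : CommRing (Fn V) := inferInstanceAs (CommRing (functionRing V))

/-- The module `Φ(V)` of differential 1-forms: finite sums `∑ fⁱ dhⁱ`, encoded by the finitely
supported family of the coefficients `fⁱ`. -/
def Form (V : Opens (ι → ℝ)) : Type _ := ι →₀ Fn V

instance (V : Opens (ι → ℝ)) : AddCommGroup (Form V) :=
  inferInstanceAs (AddCommGroup (ι →₀ Fn V))

instance (V : Opens (ι → ℝ)) : Module (Fn V) (Form V) :=
  inferInstanceAs (Module (Fn V) (ι →₀ Fn V))

/-- The form `f dhⁱ`. -/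
def monomialForm {V : Opens (ι → ℝ)} (i : ι) : Fn V →ₗ[Fn V] Form V :=
  Finsupp.lsingle (R := Fn V) i

@[elab_as_elim]
theorem form_induction {V : Opens (ι → ℝ)} {p : Form V → Prop} (φ : Form V) (zero : p 0)
    (add : ∀ φ ψ, p φ → p ψ → p (φ + ψ)) (single : ∀ i f, p (monomialForm i f)) : p φ :=
  Finsupp.induction_linear (motive := p) φ zero add single

/-- The module `𝓣(V)` of vector fields: possibly infinite sums `∑ zⁱ ∂/∂hⁱ`, encoded by the
arbitrary family of the coefficients `zⁱ`. -/
abbrev VField (V : Opens (ι → ℝ)) : Type _ := ι → Fn V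

/-- The duality pairing `φ(Z) = ∑ fⁱ zⁱ`. -/
def pairing {V : Opens (ι → ℝ)} (Z : VField V) : Form V →ₗ[Fn V] Fn V :=
  Finsupp.linearCombination (Fn V) Z

theorem pairing_monomialForm {V : Opens (ι → ℝ)} (Z : VField V) (i : ι) (f : Fn V) :
    pairing Z (monomialForm i f) = f * Z i := by
  change Finsupp.linearCombination (Fn V) Z (Finsupp.single i f) = f * Z i
  rw [Finsupp.linearCombination_single, smul_eq_mul]

open Classical in
/-- The partial derivative `∂f/∂hⁱ` as a function on the open set `V`. The extension of `f` by
zero outside of `V` is a mere device, the derivative at a point of `V` depends only on the values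
in `V`. -/
def partialFun {V : Opens (ι → ℝ)} (i : ι) (f : V → ℝ) (x : V) : ℝ :=
  deriv (fun t : ℝ => Function.extend Subtype.val f 0 (Function.update (x : ι → ℝ) i t))
    ((x : ι → ℝ) i)

theorem isOpen_restrict_image (V : Opens (ι → ℝ)) (s : Finset ι) :
    IsOpen (s.restrict '' (V : Set (ι → ℝ))) := by
  classical
  rw [isOpen_iff_mem_nhds]
  rintro _ ⟨x, hx, rfl⟩
  let σ : (s → ℝ) → ι → ℝ := fun y i => if h : i ∈ s then y ⟨i, h⟩ else x i
  have hσ : Continuous σ := by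
    refine continuous_pi fun i => ?_
    by_cases h : i ∈ s
    · simpa [σ, h] using continuous_apply (⟨i, h⟩ : s)
    · simpa [σ, h] using continuous_const
  have hσx : σ (s.restrict x) = x := by
    funext i
    by_cases h : i ∈ s <;> simp [σ, h]
  have hmem : σ ⁻¹' (V : Set (ι → ℝ)) ∈ nhds (s.restrict x) :=
    (V.isOpen.preimage hσ).mem_nhds (by simpa [hσx] using hx)
  refine Filter.mem_of_superset hmem fun y hy => ⟨σ y, hy, ?_⟩
  funext i
  simp [σ, i.2]

/-- Along a coordinate line the function `f` has the derivative given by the function `g` of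
finitely many variables which represents it. -/
theorem hasDerivAt_line {V : Opens (ι → ℝ)} {s : Finset ι} {f : V → ℝ} {g : (s → ℝ) → ℝ}
    (hg : ContDiffOn ℝ (⊤ : ℕ∞) g (s.restrict '' (V : Set (ι → ℝ))))
    (hfg : ∀ x : V, f x = g (s.restrict (x : ι → ℝ))) [DecidableEq ι] (i : ι) (x : V) :
    HasDerivAt
      (fun t : ℝ => Function.extend Subtype.val f 0 (Function.update (x : ι → ℝ) i t))
      (fderiv ℝ g (s.restrict (x : ι → ℝ)) (fun j => if (j : ι) = i then 1 else 0))
      ((x : ι → ℝ) i) := by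
  have hcont : Continuous fun t : ℝ => Function.update (x : ι → ℝ) i t :=
    continuous_const.update i continuous_id
  have hev : ∀ᶠ t in nhds ((x : ι → ℝ) i), Function.update (x : ι → ℝ) i t ∈ V :=
    (V.isOpen.preimage hcont).mem_nhds (by simp)
  have hgd : DifferentiableAt ℝ g (s.restrict (x : ι → ℝ)) :=
    (hg.contDiffAt ((isOpen_restrict_image V s).mem_nhds ⟨x, x.2, rfl⟩)).differentiableAt
      (by simp)
  have hline : HasDerivAt (fun t : ℝ => s.restrict (Function.update (x : ι → ℝ) i t))
      (fun j => if (j : ι) = i then 1 else 0) ((x : ι → ℝ) i) := by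
    rw [hasDerivAt_pi]
    intro j
    by_cases h : (j : ι) = i
    · simp only [Finset.restrict, h, Function.update_self, if_true]
      exact hasDerivAt_id _
    · simp only [Finset.restrict, ne_eq, h, not_false_eq_true, Function.update_of_ne, if_false]
      exact hasDerivAt_const _ _
  have hcomp := HasFDerivAt.comp_hasDerivAt_of_eq ((x : ι → ℝ) i) hgd.hasFDerivAt hline
    (by simp)
  refine hcomp.congr_of_eventuallyEq (hev.mono fun t ht => ?_)
  have := Subtype.val_injective.extend_apply f 0
    (⟨Function.update (x : ι → ℝ) i t, ht⟩ : V)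
  simp only [Function.comp]
  rw [← hfg ⟨_, ht⟩]
  exact this

theorem partialFun_eq {V : Opens (ι → ℝ)} {s : Finset ι} {f : V → ℝ} {g : (s → ℝ) → ℝ}
    (hg : ContDiffOn ℝ (⊤ : ℕ∞) g (s.restrict '' (V : Set (ι → ℝ))))
    (hfg : ∀ x : V, f x = g (s.restrict (x : ι → ℝ))) [DecidableEq ι] (i : ι) (x : V) :
    partialFun i f x =
      fderiv ℝ g (s.restrict (x : ι → ℝ)) (fun j => if (j : ι) = i then 1 else 0) := by
  have h := (hasDerivAt_line hg hfg i x).deriv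
  rw [← h, partialFun]
  congr!

theorem partialFun_mem {V : Opens (ι → ℝ)} {s : Finset ι} {f : V → ℝ}
    (hf : DependsSmoothlyOn V s f) (i : ι) : DependsSmoothlyOn V s (partialFun i f) := by
  classical
  obtain ⟨g, hg, hfg⟩ := hf
  exact ⟨fun y => fderiv ℝ g y (fun j => if (j : ι) = i then 1 else 0),
    (hg.fderiv_of_isOpen (isOpen_restrict_image V s) (by simp)).clm_apply contDiffOn_const,
    fun x => partialFun_eq hg hfg i x⟩

theorem partialFun_eq_zero {V : Opens (ι → ℝ)} {s : Finset ι} {f : V → ℝ}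
    (hf : DependsSmoothlyOn V s f) {i : ι} (hi : i ∉ s) : partialFun i f = 0 := by
  classical
  obtain ⟨g, hg, hfg⟩ := hf
  funext x
  rw [partialFun_eq hg hfg i x]
  have : (fun j : s => if (j : ι) = i then (1 : ℝ) else 0) = 0 := by
    funext j
    have : (j : ι) ≠ i := fun h => hi (h ▸ j.2)
    simp [this]
  simp [this]

/-- The partial derivative `∂f/∂hⁱ ∈ 𝓕(V)` of `f ∈ 𝓕(V)`. -/
def partialDeriv {V : Opens (ι → ℝ)} (i : ι) (f : Fn V) : Fn V :=
  ⟨partialFun i f.1, f.2.choose, partialFun_mem f.2.choose_spec i⟩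

theorem partialFun_differentiable {V : Opens (ι → ℝ)} [DecidableEq ι] (f : Fn V) (i : ι) (x : V) :
    HasDerivAt
      (fun t : ℝ => Function.extend Subtype.val f.1 0 (Function.update (x : ι → ℝ) i t))
      (partialFun i f.1 x) ((x : ι → ℝ) i) := by
  obtain ⟨s, g, hg, hfg⟩ := f.2
  rw [partialFun_eq hg hfg]
  exact hasDerivAt_line hg hfg i x

theorem extend_apply_update {V : Opens (ι → ℝ)} [DecidableEq ι] (f : V → ℝ) (i : ι) (x : V) :
    Function.extend Subtype.val f 0 (Function.update (x : ι → ℝ) i ((x : ι → ℝ) i)) = f x := by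
  rw [Function.update_eq_self]
  exact Subtype.val_injective.extend_apply f 0 x

theorem extend_mul {V : Opens (ι → ℝ)} (f g : V → ℝ) (y : ι → ℝ) :
    Function.extend Subtype.val (f * g) 0 y =
      Function.extend Subtype.val f 0 y * Function.extend Subtype.val g 0 y := by
  by_cases hy : y ∈ V
  · have h := fun u : V → ℝ => Subtype.val_injective.extend_apply u 0 (⟨y, hy⟩ : V)
    simp only at h
    rw [h, h, h, Pi.mul_apply]
  · have h := fun u : V → ℝ => Function.extend_apply' (f := (Subtype.val : V → ι → ℝ)) u 0 y
      (by rintro ⟨z, rfl⟩; exact hy z.2)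
    rw [h, h, h]
    simp

theorem extend_add {V : Opens (ι → ℝ)} (f g : V → ℝ) (y : ι → ℝ) :
    Function.extend Subtype.val (f + g) 0 y =
      Function.extend Subtype.val f 0 y + Function.extend Subtype.val g 0 y := by
  by_cases hy : y ∈ V
  · have h := fun u : V → ℝ => Subtype.val_injective.extend_apply u 0 (⟨y, hy⟩ : V)
    simp only at h
    rw [h, h, h, Pi.add_apply]
  · have h := fun u : V → ℝ => Function.extend_apply' (f := (Subtype.val : V → ι → ℝ)) u 0 y
      (by rintro ⟨z, rfl⟩; exact hy z.2)
    rw [h, h, h]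
    simp

theorem partialDeriv_add {V : Opens (ι → ℝ)} (i : ι) (f g : Fn V) :
    partialDeriv i (f + g) = partialDeriv i f + partialDeriv i g := by
  classical
  refine Subtype.ext (funext fun x => ?_)
  have h1 := (partialFun_differentiable f i x).add (partialFun_differentiable g i x)
  have h2 := partialFun_differentiable (f + g) i x
  refine h2.unique (h1.congr_of_eventuallyEq (Filter.Eventually.of_forall fun t => ?_))
  exact extend_add f.1 g.1 _

theorem partialDeriv_mul {V : Opens (ι → ℝ)} (i : ι) (f g : Fn V) :
    partialDeriv i (f * g) = f * partialDeriv i g + g * partialDeriv i f := by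
  classical
  refine Subtype.ext (funext fun x => ?_)
  have h1 := (partialFun_differentiable f i x).mul (partialFun_differentiable g i x)
  have h2 := partialFun_differentiable (f * g) i x
  have h3 := h2.unique (h1.congr_of_eventuallyEq (Filter.Eventually.of_forall fun t => by
    exact extend_mul f.1 g.1 _))
  rw [extend_apply_update, extend_apply_update] at h3
  change partialFun i (f * g : Fn V).1 x =
    f.1 x * partialFun i g.1 x + g.1 x * partialFun i f.1 x
  rw [h3]
  ring

/-- The differential `df = ∑ (∂f/∂hⁱ) dhⁱ`. -/
def differential {V : Opens (ι → ℝ)} (f : Fn V) : Form V :=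
  Finsupp.ofSupportFinite (fun i => partialDeriv i f) (by
    obtain ⟨s, hs⟩ := f.2
    refine s.finite_toSet.subset fun i hi => ?_
    by_contra h
    exact hi (Subtype.ext (partialFun_eq_zero hs h)))

theorem differential_add {V : Opens (ι → ℝ)} (f g : Fn V) :
    differential (f + g) = differential f + differential g := by
  exact Finsupp.ext (α := ι) (M := Fn V) fun i => partialDeriv_add i f g

theorem differential_mul {V : Opens (ι → ℝ)} (f g : Fn V) :
    differential (f * g) = f • differential g + g • differential f := by
  exact Finsupp.ext (α := ι) (M := Fn V) fun i => partialDeriv_mul i f g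

theorem differential_zero {V : Opens (ι → ℝ)} : differential (0 : Fn V) = 0 := by
  have h := differential_add (0 : Fn V) 0
  rw [add_zero] at h
  exact left_eq_add.mp h

/-- The action `Zf = df(Z)` of a vector field on a function. -/
def act {V : Opens (ι → ℝ)} (Z : VField V) (f : Fn V) : Fn V := pairing Z (differential f)

/-- The contraction `Z ⌟ dφ` where `dφ = ∑ dfⁱ ∧ dhⁱ` for the form `φ = ∑ fⁱ dhⁱ`; explicitly
`Z ⌟ dφ = ∑ ((Zfⁱ) dhⁱ - (Zhⁱ) dfⁱ)`. -/
def contractDiff {V : Opens (ι → ℝ)} (Z : VField V) (φ : Form V) : Form V :=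
  Finsupp.sum φ fun i f => monomialForm i (act Z f) - Z i • differential f

/-- The Lie derivative `𝓛_Z φ = Z ⌟ dφ + d(Z ⌟ φ)`. -/
def lieDeriv {V : Opens (ι → ℝ)} (Z : VField V) (φ : Form V) : Form V :=
  contractDiff Z φ + differential (pairing Z φ)

theorem act_add {V : Opens (ι → ℝ)} (Z : VField V) (f g : Fn V) :
    act Z (f + g) = act Z f + act Z g := by
  simp [act, differential_add]

theorem act_mul {V : Opens (ι → ℝ)} (Z : VField V) (f g : Fn V) :
    act Z (f * g) = f * act Z g + g * act Z f := by
  simp [act, differential_mul]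

theorem contractDiff_add {V : Opens (ι → ℝ)} (Z : VField V) (φ ψ : Form V) :
    contractDiff Z (φ + ψ) = contractDiff Z φ + contractDiff Z ψ := by
  classical
  refine Finsupp.sum_add_index' (fun i => ?_) (fun i f g => ?_)
  · simp [act, differential_zero]
  · rw [act_add, differential_add, map_add, smul_add]
    abel

theorem contractDiff_single {V : Opens (ι → ℝ)} (Z : VField V) (i : ι) (f : Fn V) :
    contractDiff Z (monomialForm i f) = monomialForm i (act Z f) - Z i • differential f :=
  Finsupp.sum_single_index (by simp [act, differential_zero])

theorem lieDeriv_add {V : Opens (ι → ℝ)} (Z : VField V) (φ ψ : Form V) :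
    lieDeriv Z (φ + ψ) = lieDeriv Z φ + lieDeriv Z ψ := by
  rw [lieDeriv, lieDeriv, lieDeriv, contractDiff_add, map_add, differential_add]
  abel

theorem lieDeriv_zero {V : Opens (ι → ℝ)} (Z : VField V) : lieDeriv Z 0 = 0 := by
  have h := lieDeriv_add Z 0 0
  rw [add_zero] at h
  exact left_eq_add.mp h

/-- The Leibniz rule `𝓛_Z(fφ) = f 𝓛_Z φ + (Zf) φ`. -/
theorem lieDeriv_smul {V : Opens (ι → ℝ)} (Z : VField V) (f : Fn V) (φ : Form V) :
    lieDeriv Z (f • φ) = f • lieDeriv Z φ + act Z f • φ := by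
  induction φ using form_induction with
  | zero => simp [lieDeriv_zero]
  | add φ ψ h₁ h₂ =>
    rw [smul_add, lieDeriv_add, h₁, h₂, lieDeriv_add, smul_add, smul_add]
    abel
  | single i g =>
    have e1 : f • monomialForm i g = monomialForm (V := V) i (f * g) := by
      rw [← smul_eq_mul, map_smul]
    have e2 : monomialForm (V := V) i (f * act Z g) = f • monomialForm i (act Z g) := by
      rw [← smul_eq_mul, map_smul]
    have e3 : monomialForm (V := V) i (g * act Z f) = act Z f • monomialForm i g := by
      rw [mul_comm, ← smul_eq_mul, map_smul]
    rw [e1, lieDeriv, lieDeriv, contractDiff_single, contractDiff_single, pairing_monomialForm,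
      pairing_monomialForm, act_mul, mul_assoc, differential_mul, differential_mul,
      differential_mul, map_add, e2, e3]
    module

/-! ### Diffieties and good filtrations -/

variable {V : Opens (ι → ℝ)}

theorem pairing_zero_left (φ : Form V) : pairing (0 : VField V) φ = 0 := by
  induction φ using form_induction with
  | zero => simp
  | add φ ψ h₁ h₂ =>
    rw [map_add, h₁, h₂, add_zero]
  | single i g =>
    rw [pairing_monomialForm, Pi.zero_apply, mul_zero]

theorem pairing_add_left (X Y : VField V) (φ : Form V) :
    pairing (X + Y) φ = pairing X φ + pairing Y φ := by
  induction φ using form_induction with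
  | zero => simp
  | add φ ψ h₁ h₂ =>
    rw [map_add, map_add, map_add, h₁, h₂]
    ring
  | single i g =>
    simp only [pairing_monomialForm, Pi.add_apply, mul_add]

theorem pairing_smul_left (f : Fn V) (X : VField V) (φ : Form V) :
    pairing (f • X) φ = f * pairing X φ := by
  induction φ using form_induction with
  | zero => simp
  | add φ ψ h₁ h₂ =>
    rw [map_add, map_add, h₁, h₂, mul_add]
  | single i g =>
    simp only [pairing_monomialForm, Pi.smul_apply, smul_eq_mul]
    ring

/-- The orthogonal submodule `Ω^⊥` of vector fields annihilated by all forms in `Ω`. -/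
def orth (Ω : Submodule (Fn V) (Form V)) : Submodule (Fn V) (VField V) where
  carrier := {Z | ∀ ω ∈ Ω, pairing Z ω = 0}
  zero_mem' := fun ω _ => pairing_zero_left ω
  add_mem' := by
    intro X Y hX hY ω hω
    rw [pairing_add_left, hX ω hω, hY ω hω, add_zero]
  smul_mem' := by
    intro f X hX ω hω
    rw [pairing_smul_left, hX ω hω, mul_zero]

/-- The submodule `𝓛_𝓗 Θ` generated by all forms `𝓛_Z ϑ` with `Z ∈ 𝓗` and `ϑ ∈ Θ`. -/
def lieSpan (H : Submodule (Fn V) (VField V)) (Θ : Submodule (Fn V) (Form V)) :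
    Submodule (Fn V) (Form V) :=
  Submodule.span (Fn V) {ψ | ∃ Z ∈ H, ∃ ϑ ∈ Θ, ψ = lieDeriv Z ϑ}

/-- A good filtration `Ω_0 ⊂ Ω_1 ⊂ ⋯ ⊂ Ω = ⋃ Ω_l`, with `𝓗 = Ω^⊥`. A module of finite dimension
is a module with a finite basis. -/
structure IsGoodFiltration (Ω : Submodule (Fn V) (Form V))
    (F : ℕ → Submodule (Fn V) (Form V)) : Prop where
  mono : ∀ l, F l ≤ F (l + 1)
  iSup_eq : ⨆ l, F l = Ω
  finite : ∀ l, Module.Finite (Fn V) (F l)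
  free : ∀ l, Module.Free (Fn V) (F l)
  lie_le : ∀ l, lieSpan (orth Ω) (F l) ≤ F (l + 1)
  eventually_eq : ∃ L, ∀ l, L ≤ l → F l ⊔ lieSpan (orth Ω) (F l) = F (l + 1)

/-- A diffiety: a submodule of finite codimension (the factor module has a finite basis) which
admits a good filtration. -/
structure IsDiffiety (Ω : Submodule (Fn V) (Form V)) : Prop where
  finite_codim : Module.Finite (Fn V) (Form V ⧸ Ω)
  free_codim : Module.Free (Fn V) (Form V ⧸ Ω)
  exists_good : ∃ F : ℕ → Submodule (Fn V) (Form V), IsGoodFiltration Ω F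

/-- The `c`-lift `Ω_{*+c}`. -/
def lift (F : ℕ → Submodule (Fn V) (Form V)) (c : ℕ) : ℕ → Submodule (Fn V) (Form V) :=
  fun l => F (l + c)

/-! ### The graded module and multiplications -/

/-- The term `Ω_{l-1}`, where `Ω_{-1} = 0`. -/
def prevTerm (F : ℕ → Submodule (Fn V) (Form V)) : ℕ → Submodule (Fn V) (Form V)
  | 0 => ⊥
  | l + 1 => F l

/-- The graded component `𝓜_l = Ω_l / Ω_{l-1}`. -/
abbrev Gr (F : ℕ → Submodule (Fn V) (Form V)) (l : ℕ) : Type _ :=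
  F l ⧸ (prevTerm F l).submoduleOf (F l)

variable {Ω : Submodule (Fn V) (Form V)} {F : ℕ → Submodule (Fn V) (Form V)}

theorem IsGoodFiltration.lieDeriv_mem (h : IsGoodFiltration Ω F) {Z : VField V}
    (hZ : Z ∈ orth Ω) {l : ℕ} {ω : Form V} (hω : ω ∈ F l) : lieDeriv Z ω ∈ F (l + 1) :=
  h.lie_le l (Submodule.subset_span ⟨Z, hZ, ω, hω, rfl⟩)

/-- The `𝓕`-linear map `Ω_l → 𝓜_{l+1}`, `ω ↦ [𝓛_Z ω]`. -/
def lieClass (h : IsGoodFiltration Ω F) (Z : orth Ω) (l : ℕ) :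
    F l →ₗ[Fn V] Gr F (l + 1) where
  toFun ω := Submodule.Quotient.mk ⟨lieDeriv Z.1 ω.1, h.lieDeriv_mem Z.2 ω.2⟩
  map_add' ω₁ ω₂ := by
    rw [← Submodule.Quotient.mk_add]
    congr 1
    exact Subtype.ext (lieDeriv_add Z.1 ω₁.1 ω₂.1)
  map_smul' f ω := by
    rw [RingHom.id_apply, ← Submodule.Quotient.mk_smul, Submodule.Quotient.eq]
    change lieDeriv Z.1 (f • ω.1) - f • lieDeriv Z.1 ω.1 ∈ F l
    rw [lieDeriv_smul, add_sub_cancel_left]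
    exact (F l).smul_mem _ ω.2

/-- The multiplication `Z : 𝓜_l → 𝓜_{l+1}`, `Z[ω] = [𝓛_Z ω]`, for `Z ∈ 𝓗`. -/
def mult (h : IsGoodFiltration Ω F) (Z : orth Ω) (l : ℕ) : Gr F l →ₗ[Fn V] Gr F (l + 1) :=
  Submodule.liftQ _ (lieClass h Z l) (by
    intro ω hω
    rw [LinearMap.mem_ker]
    refine (Submodule.Quotient.mk_eq_zero _).2 ?_
    change lieDeriv Z.1 ω.1 ∈ F l
    cases l with
    | zero =>
      have h0 : ω.1 = 0 := hω
      rw [h0, lieDeriv_zero]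
      exact Submodule.zero_mem _
    | succ l => exact h.lieDeriv_mem Z.2 hω)

/-- The component `𝓐(i)𝓜 ∩ 𝓜_l`, where `𝓐(i)` is the ideal generated by the first `i` terms of the
family `Z` in the algebra `𝓐` of polynomials over `𝓗`. An `𝓐`-submodule of `𝓜` is an
`𝓕`-submodule stable under all multiplications by elements of `𝓗`, so `𝓐(i)𝓜` is the least such
submodule which contains `Z_j m` for all `m ∈ 𝓜` and the first `i` of the indices `j`. -/
def idealPart (h : IsGoodFiltration Ω F) {n : ℕ} (Z : Fin n → orth Ω) (i : ℕ) :
    (l : ℕ) → Submodule (Fn V) (Gr F l)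
  | 0 => ⊥
  | l + 1 => (⨆ j : Fin n, ⨆ _ : (j : ℕ) < i, LinearMap.range (mult h (Z j) l)) ⊔
      ⨆ X : orth Ω, (idealPart h Z i l).map (mult h X l)

/-- The component `𝓜(i)_l` of the graded module `𝓜(i) = 𝓜 / 𝓐(i)𝓜`. -/
abbrev GrMod (h : IsGoodFiltration Ω F) {n : ℕ} (Z : Fin n → orth Ω) (i l : ℕ) : Type _ :=
  Gr F l ⧸ idealPart h Z i l

/-- The multiplication `X : 𝓜(i)_l → 𝓜(i)_{l+1}` for `X ∈ 𝓗`. -/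
def multMod (h : IsGoodFiltration Ω F) {n : ℕ} (Z : Fin n → orth Ω) (i l : ℕ) (X : orth Ω) :
    GrMod h Z i l →ₗ[Fn V] GrMod h Z i (l + 1) :=
  Submodule.mapQ _ _ (mult h X l) (by
    rw [← Submodule.map_le_iff_le_comap]
    exact le_sup_of_le_right (le_iSup (fun X : orth Ω => (idealPart h Z i l).map (mult h X l)) X))

/-- The basis `Z_1, …, Z_n` of `𝓗` (here with the indices `0, …, n - 1`) is quasiregular if all
multiplications `Z_{i+1} : 𝓜(i)_l → 𝓜(i)_{l+1}` with `0 ≤ i ≤ n - 1` and `l ≥ 1` are injective. -/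
def IsQuasiregular (h : IsGoodFiltration Ω F) {n : ℕ}
    (Z : Module.Basis (Fin n) (Fn V) (orth Ω)) : Prop :=
  ∀ (i : Fin n) (l : ℕ), 1 ≤ l → Function.Injective (multMod h Z i l (Z i))

/-- Involutive filtrations. -/
def IsInvolutive (h : IsGoodFiltration Ω F) : Prop :=
  (∃ (n : ℕ) (Z : Module.Basis (Fin n) (Fn V) (orth Ω)), IsQuasiregular h Z) ∧
    ∀ l, F l ⊔ lieSpan (orth Ω) (F l) = F (l + 1)

/-! ### Restriction to a smaller open set -/

/-- The restriction of functions. -/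
def restrictFn {U V : Opens (ι → ℝ)} (hUV : U ≤ V) (f : Fn V) : Fn U :=
  ⟨fun x => f.1 ⟨x.1, hUV x.2⟩, by
    obtain ⟨s, g, hg, hfg⟩ := f.2
    exact ⟨s, g, hg.mono (Set.image_mono hUV), fun x => hfg ⟨x.1, hUV x.2⟩⟩⟩

/-- The restriction of differential forms. -/
def restrictForm {U V : Opens (ι → ℝ)} (hUV : U ≤ V) (φ : Form V) : Form U :=
  Finsupp.mapRange (restrictFn hUV) rfl φ

/-- The restriction of a submodule of forms: the `𝓕(U)`-submodule generated by the restrictions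
of its elements. -/
def restrict {U V : Opens (ι → ℝ)} (hUV : U ≤ V) (Θ : Submodule (Fn V) (Form V)) :
    Submodule (Fn U) (Form U) :=
  Submodule.span (Fn U) (restrictForm hUV '' (Θ : Set (Form V)))

end Diffiety

end

/-!
Near a given point all sufficiently high lifts of the filtration are involutive for the following
reason.

The module `𝓗` is closed under commutators, so that the multiplications by vector fields in `𝓗`
commute on the graded module `𝓜` (`mult_comm`), and a dual frame of `𝓗` makes `𝓜` a graded module
over a polynomial ring which is generated in bounded degree (`iSup_range_mult_eq_top`).

*At the point `P`.* The fibre of `𝓜` is a finitely generated graded module over `ℝ[Z_1, …, Z_n]`. In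
large degrees its socle vanishes, so no associated prime contains all variables, and a generic
linear form, which avoids the finitely many associated primes, is injective
(`exists_comb_injective`). Repeating this modulo the linear forms already chosen gives a constant
change of the frame after which the basis is quasiregular in large degrees
(`exists_quasiregular_family`).

*From the point to a neighbourhood.* Infinitely many degrees are to be treated on a single
neighbourhood, over a ring which is not Noetherian. In one large degree choose a basis of the fibre
adapted to the flag of the submodules `Z_1 𝓜 + ⋯ + Z_j 𝓜`. Every element `b` of the basis gets
multiplicative variables `Z_1, …, Z_k` such that in all higher degrees the products `Z^α b` by
monomials in the multiplicative variables are exactly as many as the dimension of the fibre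
(`exists_classedType`). That the products of degree one span is a condition on finitely many
elements, which by Nakayama's lemma persists on a neighbourhood `U`
(`exists_classedType_of_residue`). It implies, over any ring, that the products span in all higher
degrees (`top_le_span_nextFamily`). Since the components of `𝓜` are free, and remain free of the
same rank over `U` (`nonempty_basis_restrict`), the products are bases of all components over `U`,
and quasiregularity over `U` can be read off from these bases (`mem_imageSum_of_card_eq_finrank`).
-/

namespace Diffiety

/-! ### Commuting operators on a graded module -/

section Graded

variable {R : Type*} [CommRing R] {N : ℕ → Type*} [∀ l, AddCommGroup (N l)]
  [∀ l, Module R (N l)]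

/-- The sum `∑_{j < i} T_j N_l ⊂ N_{l+1}` of the images of the first `i` operators. -/
def imageSum (T : ℕ → ∀ l, N l →ₗ[R] N (l + 1)) (i l : ℕ) : Submodule R (N (l + 1)) :=
  ⨆ j ∈ Finset.range i, LinearMap.range (T j l)

variable {T : ℕ → ∀ l, N l →ₗ[R] N (l + 1)}

theorem imageSum_zero (l : ℕ) : imageSum T 0 l = ⊥ := by
  simp [imageSum]

theorem imageSum_succ (i l : ℕ) :
    imageSum T (i + 1) l = imageSum T i l ⊔ LinearMap.range (T i l) := by
  rw [imageSum, imageSum, Finset.range_add_one, Finset.iSup_insert, sup_comm]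

theorem apply_mem_imageSum {i j l : ℕ} (h : j < i) (x : N l) : T j l x ∈ imageSum T i l :=
  Submodule.mem_iSup_of_mem j
    (Submodule.mem_iSup_of_mem (Finset.mem_range.2 h) (LinearMap.mem_range_self _ x))

theorem imageSum_le_iff {i l : ℕ} {S : Submodule R (N (l + 1))} :
    imageSum T i l ≤ S ↔ ∀ j < i, ∀ x, T j l x ∈ S := by
  simp only [imageSum, iSup_le_iff, Finset.mem_range, LinearMap.range_le_iff_comap,
    Submodule.eq_top_iff', Submodule.mem_comap]

theorem imageSum_mono {i j : ℕ} (hij : i ≤ j) (l : ℕ) : imageSum T i l ≤ imageSum T j l :=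
  imageSum_le_iff.2 fun _ hk _ => apply_mem_imageSum (hk.trans_le hij) _

theorem apply_mem_imageSum_succ
    (hT : ∀ i j l (x : N l), T i (l + 1) (T j l x) = T j (l + 1) (T i l x))
    (i j : ℕ) {l : ℕ} {x : N (l + 1)} (hx : x ∈ imageSum T i l) :
    T j (l + 1) x ∈ imageSum T i (l + 1) := by
  have : imageSum T i l ≤ (imageSum T i (l + 1)).comap (T j (l + 1)) := by
    rw [imageSum_le_iff]
    intro k hk y
    rw [Submodule.mem_comap, hT]
    exact apply_mem_imageSum hk _
  exact this hx

theorem imageSum_congr {T' : ℕ → ∀ l, N l →ₗ[R] N (l + 1)} {i l : ℕ}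
    (h : ∀ j < i, T j l = T' j l) : imageSum T i l = imageSum T' i l := by
  refine le_antisymm (imageSum_le_iff.2 fun j hj x => ?_) (imageSum_le_iff.2 fun j hj x => ?_)
  · rw [h j hj]
    exact apply_mem_imageSum hj x
  · rw [← h j hj]
    exact apply_mem_imageSum hj x

end Graded

/-! ### Families of generators with multiplicative variables -/

/-- A finite set of generators, where the generator `b` has the first `mult b` variables as its
multiplicative variables. -/
structure ClassedType where
  /-- The index set of the generators. -/
  B : Type
  [fintype : Fintype B]
  /-- The number of multiplicative variables. -/
  mult : B → ℕ

attribute [instance] ClassedType.fintype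

namespace ClassedType

/-- The products `Z_k b` of the generators by their multiplicative variables, where `Z_k b` gets
the multiplicative variables `Z_0, …, Z_k`. -/
def next (X : ClassedType) : ClassedType where
  B := Σ b : X.B, Fin (X.mult b)
  mult p := p.2 + 1

/-- The set of all products `Z^α b` of degree `m` with `Z^α` a monomial in the multiplicative
variables of `b`; each product occurs once, the indices of the successive factors being
nonincreasing. -/
def nextIter (X : ClassedType) : ℕ → ClassedType
  | 0 => X
  | m + 1 => (X.nextIter m).next

/-- The number of generators for which the variable of index `j` is multiplicative. -/
def count (X : ClassedType) (j : ℕ) : ℕ := ∑ b : X.B, if j < X.mult b then 1 else 0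

theorem card_next {X : ClassedType} {n : ℕ} (hX : ∀ b, X.mult b ≤ n) :
    Fintype.card X.next.B = ∑ j ∈ Finset.range n, X.count j := by
  have h1 : Fintype.card X.next.B = ∑ b : X.B, X.mult b := by
    change Fintype.card (Σ b : X.B, Fin (X.mult b)) = _
    simp
  rw [h1]
  simp only [count]
  rw [Finset.sum_comm]
  refine Finset.sum_congr rfl fun b _ => ?_
  rw [Finset.sum_boole]
  have : (Finset.range n).filter (fun j => j < X.mult b) = Finset.range (X.mult b) := by
    ext j
    have := hX b
    simp only [Finset.mem_filter, Finset.mem_range]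
    omega
  rw [this]
  simp

theorem count_next {X : ClassedType} {n : ℕ} (hX : ∀ b, X.mult b ≤ n) (j : ℕ) :
    X.next.count j = ∑ k ∈ Finset.Ico j n, X.count k := by
  have h1 : X.next.count j = ∑ b : X.B, ∑ k : Fin (X.mult b), if j < (k : ℕ) + 1 then 1 else 0 := by
    change ∑ p : (Σ b : X.B, Fin (X.mult b)), (if j < (p.2 : ℕ) + 1 then 1 else 0) = _
    rw [Fintype.sum_sigma]
  rw [h1]
  simp only [count]
  rw [Finset.sum_comm]
  refine Finset.sum_congr rfl fun b _ => ?_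
  rw [Fin.sum_univ_eq_sum_range (fun k => if j < k + 1 then 1 else 0), Finset.sum_boole,
    Finset.sum_boole]
  congr 2
  ext k
  have := hX b
  simp only [Finset.mem_filter, Finset.mem_range, Finset.mem_Ico]
  omega

theorem mult_next_le {X : ClassedType} {n : ℕ} (hX : ∀ b, X.mult b ≤ n) (p : X.next.B) :
    X.next.mult p ≤ n := by
  have h1 := hX p.1
  have h2 := p.2.2
  change (p.2 : ℕ) + 1 ≤ n
  omega

theorem mult_nextIter_le {X : ClassedType} {n : ℕ} (hX : ∀ b, X.mult b ≤ n) (m : ℕ) :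
    ∀ b, (X.nextIter m).mult b ≤ n := by
  induction m with
  | zero => exact hX
  | succ m ih => exact mult_next_le ih

end ClassedType

section Span

variable {R : Type*} [CommRing R] {N : ℕ → Type*} [∀ l, AddCommGroup (N l)]
  [∀ l, Module R (N l)]

/-- The family of the products of the elements `e b` by their multiplicative variables. -/
def nextFamily (T : ℕ → ∀ l, N l →ₗ[R] N (l + 1)) {X : ClassedType} {l : ℕ} (e : X.B → N l) :
    X.next.B → N (l + 1) :=
  fun p => T p.2 l (e p.1)

variable {T : ℕ → ∀ l, N l →ₗ[R] N (l + 1)}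
  (hT : ∀ i j l (x : N l), T i (l + 1) (T j l x) = T j (l + 1) (T i l x))
include hT

/-- If the multiplicative products of degree one span, then a product by any variable `T_j` is a
combination of multiplicative products of degree two which end with a variable of index at most
`j`: for a non-multiplicative `j`, the product `T_j T_k e_b = T_k (T_j e_b)` involves the smaller
variable `k`. -/
theorem range_le_span_nextFamily {X : ClassedType} {l : ℕ} {e : X.B → N l}
    (he : ⊤ ≤ Submodule.span R (Set.range (nextFamily T e))) (j : ℕ) :
    LinearMap.range (T j (l + 1)) ≤ Submodule.span R
      (nextFamily T (nextFamily T e) '' {p : X.next.next.B | (p.2 : ℕ) ≤ j}) := by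
  induction j using Nat.strong_induction_on with
  | _ j ih =>
    rw [LinearMap.range_eq_map, ← top_le_iff.1 he, Submodule.map_span, Submodule.span_le]
    rintro _ ⟨_, ⟨⟨b, k⟩, rfl⟩, rfl⟩
    by_cases hk : j ≤ k
    · refine Submodule.subset_span ⟨⟨⟨b, k⟩, ⟨j, ?_⟩⟩, le_refl j, rfl⟩
      change j < (k : ℕ) + 1
      omega
    · have hkj : (k : ℕ) < j := by omega
      have h1 : T j (l + 1) (nextFamily T e ⟨b, k⟩) = T k (l + 1) (T j l (e b)) := hT _ _ _ _
      rw [h1]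
      have hsub : {p : X.next.next.B | (p.2 : ℕ) ≤ k} ⊆ {p : X.next.next.B | (p.2 : ℕ) ≤ j} :=
        fun p hp => le_trans hp hkj.le
      exact Submodule.span_mono (Set.image_mono hsub) (ih k hkj (LinearMap.mem_range_self _ _))

theorem top_le_span_nextFamily {X : ClassedType} {l n : ℕ} {e : X.B → N l}
    (he : ⊤ ≤ Submodule.span R (Set.range (nextFamily T e))) (hgen : imageSum T n (l + 1) = ⊤) :
    ⊤ ≤ Submodule.span R (Set.range (nextFamily T (nextFamily T e))) := by
  rw [← hgen, imageSum_le_iff]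
  intro j _ x
  exact Submodule.span_mono (Set.image_subset_range _ _)
    (range_le_span_nextFamily hT he j (LinearMap.mem_range_self _ x))

/-- The injectivity of the multiplications modulo the preceding variables, if the multiplicative
products of degree one generate and those of degree two are linearly independent. Modulo the
products ending with a variable of index less than `i`, the operator `T_i` maps the products of
degree one to distinct products of degree two. -/
theorem mem_imageSum_of_linearIndependent {X : ClassedType} {l : ℕ} {e : X.B → N l}
    (he : ⊤ ≤ Submodule.span R (Set.range (nextFamily T e)))
    (hli : LinearIndependent R (nextFamily T (nextFamily T e))) {i : ℕ} {x : N (l + 1)}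
    (hx : T i (l + 1) x ∈ imageSum T i (l + 1)) : x ∈ imageSum T i l := by
  classical
  obtain ⟨c, hc⟩ := (Submodule.mem_span_range_iff_exists_fun R).1 (he (Submodule.mem_top (x := x)))
  -- the part of the expansion of `x` without the variables of index less than `i`
  set y : N (l + 1) := ∑ p : X.next.B, if i ≤ (p.2 : ℕ) then c p • nextFamily T e p else 0 with hy
  have hxy : x - y ∈ imageSum T i l := by
    rw [← hc, hy, ← Finset.sum_sub_distrib]
    refine Submodule.sum_mem _ fun p _ => ?_
    by_cases hp : i ≤ (p.2 : ℕ)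
    · simp [hp]
    · rw [if_neg hp, sub_zero]
      exact Submodule.smul_mem _ _ (apply_mem_imageSum (not_le.1 hp) _)
  have hTy : T i (l + 1) y ∈ imageSum T i (l + 1) := by
    have := Submodule.sub_mem _ hx (apply_mem_imageSum_succ hT i i hxy)
    rwa [← map_sub, sub_sub_cancel] at this
  have hle : imageSum T i (l + 1) ≤ Submodule.span R
      (nextFamily T (nextFamily T e) '' {p : X.next.next.B | (p.2 : ℕ) < i}) := by
    rw [imageSum_le_iff]
    intro j hj z
    have hsub : {p : X.next.next.B | (p.2 : ℕ) ≤ j} ⊆ {p : X.next.next.B | (p.2 : ℕ) < i} :=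
      fun p hp => lt_of_le_of_lt hp hj
    exact Submodule.span_mono (Set.image_mono hsub)
      (range_le_span_nextFamily hT he j (LinearMap.mem_range_self _ z))
  have hle' : T i (l + 1) y ∈ Submodule.span R
      (nextFamily T (nextFamily T e) '' {p : X.next.next.B | (p.2 : ℕ) < i}ᶜ) := by
    rw [hy, map_sum]
    refine Submodule.sum_mem _ fun p _ => ?_
    by_cases hp : i ≤ (p.2 : ℕ)
    · rw [if_pos hp, map_smul]
      exact Submodule.smul_mem _ _ (Submodule.subset_span
        ⟨⟨p, ⟨i, Nat.lt_succ_of_le hp⟩⟩, fun h => lt_irrefl i h, rfl⟩)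
    · rw [if_neg hp, map_zero]
      exact Submodule.zero_mem _
  have hdis := hli.disjoint_span_image (s := {p : X.next.next.B | (p.2 : ℕ) < i})
    (t := {p : X.next.next.B | (p.2 : ℕ) < i}ᶜ) disjoint_compl_right
  have hT0 : T i (l + 1) y = 0 := Submodule.disjoint_def.1 hdis _ (hle hTy) hle'
  have hc0 : ∀ p : X.next.B, i ≤ (p.2 : ℕ) → c p = 0 := by
    let q : {p : X.next.B // i ≤ (p.2 : ℕ)} → X.next.next.B :=
      fun p => ⟨p.1, ⟨i, Nat.lt_succ_of_le p.2⟩⟩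
    have hq : Function.Injective q := by
      intro p p' h
      have h' : (q p).1 = (q p').1 := by rw [h]
      exact Subtype.ext h'
    have hq' := Fintype.linearIndependent_iff.1 (hli.comp q hq) (fun p => c p.1) (by
      rw [← hT0, hy, map_sum, ← Finset.sum_filter_add_sum_filter_not Finset.univ
        (fun p : X.next.B => i ≤ (p.2 : ℕ))]
      rw [Finset.sum_eq_zero (s := Finset.univ.filter fun p : X.next.B => ¬ i ≤ (p.2 : ℕ))
        (fun p hp => by rw [if_neg (Finset.mem_filter.1 hp).2, map_zero]), add_zero,
        ← Finset.sum_subtype_eq_sum_filter, Finset.subtype_univ]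
      refine Finset.sum_congr rfl fun p _ => ?_
      rw [if_pos p.2, map_smul]
      rfl)
    intro p hp
    exact hq' ⟨p, hp⟩
  have hy0 : y = 0 := by
    rw [hy]
    refine Finset.sum_eq_zero fun p _ => ?_
    by_cases hp : i ≤ (p.2 : ℕ)
    · rw [if_pos hp, hc0 p hp, zero_smul]
    · rw [if_neg hp]
  rwa [hy0, sub_zero] at hxy

/-- Over any commutative ring, the ranks of the components and the generators of one component
determine the quasiregularity in all degrees. -/
theorem mem_imageSum_of_card_eq_finrank [∀ l, Module.Finite R (N l)] {n l₀ : ℕ}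
    (hgen : ∀ l, l₀ ≤ l → imageSum T n l = ⊤) {X : ClassedType} {e : X.B → N l₀}
    (he : ⊤ ≤ Submodule.span R (Set.range (nextFamily T e)))
    (hcard : ∀ m, Fintype.card (X.nextIter (m + 1)).B = Module.finrank R (N (l₀ + m + 1)))
    {k : ℕ} (hk : l₀ ≤ k) {i : ℕ} {x : N (k + 1)}
    (hx : T i (k + 1) x ∈ imageSum T i (k + 1)) : x ∈ imageSum T i k := by
  have key : ∀ m, ∃ e' : (X.nextIter m).B → N (l₀ + m),
      ⊤ ≤ Submodule.span R (Set.range (nextFamily T e')) := by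
    intro m
    induction m with
    | zero => exact ⟨e, he⟩
    | succ m ih =>
      obtain ⟨e', he'⟩ := ih
      exact ⟨nextFamily T e', top_le_span_nextFamily hT he'
        (hgen _ (Nat.le_succ_of_le (Nat.le_add_right l₀ m)))⟩
  obtain ⟨m, rfl⟩ := Nat.exists_eq_add_of_le hk
  obtain ⟨e', he'⟩ := key m
  exact mem_imageSum_of_linearIndependent hT he'
    (linearIndependent_of_top_le_span_of_card_eq_finrank
      (top_le_span_nextFamily hT he' (hgen _ (Nat.le_add_right_of_le hk))) (hcard (m + 1))) hx

end Span

/-! ### Generic linear combinations of operators over an infinite field -/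

/-- Commuting elements of an algebra define an action of the polynomial ring. -/
theorem exists_mvPolynomial_algHom {K E σ : Type*} [CommRing K] [Ring E] [Algebra K E] (t : σ → E)
    (ht : ∀ i j, t i * t j = t j * t i) :
    ∃ φ : MvPolynomial σ K →ₐ[K] E, ∀ i, φ (MvPolynomial.X i) = t i := by
  have hc : IsMulCommutative (Algebra.adjoin K (Set.range t)) :=
    Algebra.isMulCommutative_adjoin K (by
      rintro _ ⟨i, rfl⟩ _ ⟨j, rfl⟩
      exact ht i j)
  open scoped IsMulCommutative in
  refine ⟨(Algebra.adjoin K (Set.range t)).val.comp (MvPolynomial.aeval fun i =>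
    (⟨t i, Algebra.subset_adjoin ⟨i, rfl⟩⟩ : Algebra.adjoin K (Set.range t))), fun i => ?_⟩
  simp

section Generic

open DirectSum MvPolynomial

variable {K : Type*} [Field K] {N : ℕ → Type*} [∀ l, AddCommGroup (N l)]
  [∀ l, Module K (N l)] {n : ℕ} {T : Fin n → ∀ l, N l →ₗ[K] N (l + 1)}
  (hT : ∀ i j l (x : N l), T i (l + 1) (T j l x) = T j (l + 1) (T i l x))

include hT in
/-- The operators define an action of the polynomial ring on the direct sum of the components. -/
theorem exists_graded_action : ∃ φ : MvPolynomial (Fin n) K →ₐ[K] Module.End K (⨁ l, N l),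
    (∀ k l (x : N l), φ (X k) (lof K ℕ N l x) = lof K ℕ N (l + 1) (T k l x)) ∧
      ∀ k l (x : ⨁ l, N l), φ (X k) x (l + 1) = T k l (x l) := by
  let t : Fin n → Module.End K (⨁ l, N l) := fun k =>
    toModule K ℕ _ fun l => (lof K ℕ N (l + 1)).comp (T k l)
  have h1 : ∀ k l (x : N l), t k (lof K ℕ N l x) = lof K ℕ N (l + 1) (T k l x) := by
    intro k l x
    simp [t, toModule_lof]
  obtain ⟨φ, hφ⟩ := exists_mvPolynomial_algHom (K := K) t (by
    intro i j
    refine linearMap_ext K fun l => LinearMap.ext fun x => ?_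
    simp only [LinearMap.comp_apply, Module.End.mul_apply, h1, hT i j])
  refine ⟨φ, fun k l x => by rw [hφ, h1], fun k l x => ?_⟩
  rw [hφ]
  have h2 : (component K ℕ N (l + 1)).comp (t k) = (T k l).comp (component K ℕ N l) := by
    refine linearMap_ext K fun m => LinearMap.ext fun y => ?_
    simp only [LinearMap.comp_apply, h1]
    by_cases hm : m = l
    · subst hm
      rw [component.lof_self, component.lof_self]
    · rw [component.of, component.of, dif_neg hm, dif_neg (by omega), map_zero]
  exact LinearMap.congr_fun h2 x

/-- The direct sum of a finitely generated graded family is a Noetherian module over the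
polynomial ring. -/
theorem isNoetherian_directSum [∀ l, Module.Finite K (N l)] {L : ℕ}
    (hgen : ∀ l, L ≤ l → ⨆ k, LinearMap.range (T k l) = ⊤)
    (φ : MvPolynomial (Fin n) K →ₐ[K] Module.End K (⨁ l, N l))
    (hφ : ∀ k l (x : N l), φ (X k) (lof K ℕ N l x) = lof K ℕ N (l + 1) (T k l x)) :
    letI : Module (MvPolynomial (Fin n) K) (⨁ l, N l) := Module.compHom _ φ.toRingHom
    IsNoetherian (MvPolynomial (Fin n) K) (⨁ l, N l) := by
  classical
  let : Module (MvPolynomial (Fin n) K) (⨁ l, N l) := Module.compHom _ φ.toRingHom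
  have hsmul : ∀ (p : MvPolynomial (Fin n) K) (x : ⨁ l, N l), p • x = φ p x := fun _ _ => rfl
  choose s hs using fun l => (Module.Finite.fg_top : (⊤ : Submodule K (N l)).FG)
  let S : Finset (⨁ l, N l) := (Finset.range (L + 1)).biUnion fun l => (s l).image (lof K ℕ N l)
  have key : ∀ l (x : N l), lof K ℕ N l x ∈ Submodule.span (MvPolynomial (Fin n) K)
      (S : Set (⨁ l, N l)) := by
    intro l
    induction l with
    | zero =>
      intro x
      have hx : x ∈ Submodule.span K (s 0 : Set (N 0)) := hs 0 ▸ Submodule.mem_top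
      induction hx using Submodule.span_induction with
      | mem y hy =>
        refine Submodule.subset_span (Finset.mem_coe.2 (Finset.mem_biUnion.2
          ⟨0, Finset.mem_range.2 (Nat.succ_pos L), Finset.mem_image_of_mem _ hy⟩))
      | zero => rw [map_zero]; exact Submodule.zero_mem _
      | add y z _ _ h1 h2 => rw [map_add]; exact Submodule.add_mem _ h1 h2
      | smul a y _ h1 =>
        have h2 := Submodule.smul_mem _ (C a) h1
        rwa [hsmul, ← algebraMap_eq, AlgHom.commutes, Module.algebraMap_end_apply,
          ← map_smul] at h2
    | succ l ih =>
      intro x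
      by_cases hl : L ≤ l
      · have hx : x ∈ ⨆ k, LinearMap.range (T k l) := hgen l hl ▸ Submodule.mem_top
        induction hx using Submodule.iSup_induction' with
        | mem k y hy =>
          obtain ⟨z, rfl⟩ := hy
          rw [← hφ, ← hsmul]
          exact Submodule.smul_mem _ _ (ih z)
        | zero => rw [map_zero]; exact Submodule.zero_mem _
        | add y z _ _ h1 h2 => rw [map_add]; exact Submodule.add_mem _ h1 h2
      · have hx : x ∈ Submodule.span K (s (l + 1) : Set (N (l + 1))) :=
          hs (l + 1) ▸ Submodule.mem_top
        induction hx using Submodule.span_induction with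
        | mem y hy =>
          refine Submodule.subset_span (Finset.mem_coe.2 (Finset.mem_biUnion.2
            ⟨l + 1, Finset.mem_range.2 (by omega), Finset.mem_image_of_mem _ hy⟩))
        | zero => rw [map_zero]; exact Submodule.zero_mem _
        | add y z _ _ h1 h2 => rw [map_add]; exact Submodule.add_mem _ h1 h2
        | smul a y _ h1 =>
          have h2 := Submodule.smul_mem _ (C a) h1
          rwa [hsmul, ← algebraMap_eq, AlgHom.commutes, Module.algebraMap_end_apply,
            ← map_smul] at h2
  have hfin : Module.Finite (MvPolynomial (Fin n) K) (⨁ l, N l) := by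
    refine ⟨⟨S, top_le_iff.1 fun x _ => ?_⟩⟩
    induction x using DirectSum.induction_on with
    | zero => exact Submodule.zero_mem _
    | of l x => exact key l x
    | add x y h1 h2 => exact Submodule.add_mem _ (h1 trivial) (h2 trivial)
  exact isNoetherian_of_isNoetherianRing_of_finite _ _

include hT in
/-- In large degrees no nonzero element is annihilated by all operators. -/
theorem exists_socle_eq_zero [∀ l, Module.Finite K (N l)] {L : ℕ}
    (hgen : ∀ l, L ≤ l → ⨆ k, LinearMap.range (T k l) = ⊤) :
    ∃ k₀, ∀ l, k₀ ≤ l → ∀ x : N l, (∀ k, T k l x = 0) → x = 0 := by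
  obtain ⟨φ, h1, h2⟩ := exists_graded_action hT
  let : Module (MvPolynomial (Fin n) K) (⨁ l, N l) := Module.compHom _ φ.toRingHom
  have hsmul : ∀ (p : MvPolynomial (Fin n) K) (x : ⨁ l, N l), p • x = φ p x := fun _ _ => rfl
  have hnoeth : IsNoetherian (MvPolynomial (Fin n) K) (⨁ l, N l) :=
    isNoetherian_directSum hgen φ h1
  -- the elements of the socle which are concentrated in the degrees less than `k`
  let S : ℕ →o Submodule (MvPolynomial (Fin n) K) (⨁ l, N l) :=
    { toFun := fun k =>
        { carrier := {x | (∀ i, φ (X i) x = 0) ∧ ∀ l, k ≤ l → x l = 0}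
          zero_mem' := ⟨fun i => map_zero _, fun l _ => rfl⟩
          add_mem' := by
            rintro x y ⟨hx, hx'⟩ ⟨hy, hy'⟩
            refine ⟨fun i => by rw [map_add, hx, hy, add_zero], fun l hl => ?_⟩
            rw [DirectSum.add_apply, hx' l hl, hy' l hl, add_zero]
          smul_mem' := by
            rintro p x ⟨hx, hx'⟩
            induction p using MvPolynomial.induction_on with
            | C a =>
              rw [hsmul, ← algebraMap_eq, AlgHom.commutes, Module.algebraMap_end_apply]
              refine ⟨fun i => by rw [map_smul, hx, smul_zero], fun l hl => ?_⟩
              rw [DirectSum.smul_apply, hx' l hl, smul_zero]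
            | add p q hp hq =>
              rw [add_smul]
              refine ⟨fun i => by rw [map_add, hp.1, hq.1, add_zero], fun l hl => ?_⟩
              rw [DirectSum.add_apply, hp.2 l hl, hq.2 l hl, add_zero]
            | mul_X p i _ =>
              rw [mul_smul, hsmul (X i), hx i, smul_zero]
              exact ⟨fun i => map_zero _, fun l _ => rfl⟩ }
      monotone' := fun k m hkm x hx => ⟨hx.1, fun l hl => hx.2 l (hkm.trans hl)⟩ }
  obtain ⟨k₀, hk₀⟩ := monotone_stabilizes_iff_noetherian.2 hnoeth S
  refine ⟨k₀, fun l hl x hx => ?_⟩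
  have hmem : lof K ℕ N l x ∈ S (l + 1) := by
    refine ⟨fun i => by rw [h1, hx, map_zero], fun m hm => ?_⟩
    have := component.of K (M := N) m l x
    rw [dif_neg (by omega)] at this
    exact this
  rw [← hk₀ (l + 1) (by omega)] at hmem
  have := hmem.2 l hl
  rwa [lof_apply] at this

/-- The linear combination `∑ w_k T_k` of the operators. -/
def comb {R : Type*} [CommRing R] {N : ℕ → Type*} [∀ l, AddCommGroup (N l)] [∀ l, Module R (N l)]
    {n : ℕ} (T : Fin n → ∀ l, N l →ₗ[R] N (l + 1)) (w : Fin n → R) (l : ℕ) :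
    N l →ₗ[R] N (l + 1) :=
  ∑ k, w k • T k l

theorem comb_apply {R : Type*} [CommRing R] {N : ℕ → Type*} [∀ l, AddCommGroup (N l)]
    [∀ l, Module R (N l)] {n : ℕ} (T : Fin n → ∀ l, N l →ₗ[R] N (l + 1)) (w : Fin n → R) (l : ℕ)
    (x : N l) : comb T w l x = ∑ k, w k • T k l x := by
  simp [comb]

include hT in
/-- If no nonzero element is annihilated by all operators, then a generic combination of the
operators is injective: it avoids the finitely many associated primes, none of which contains all
variables. -/
theorem exists_comb_injective_of_socle [Infinite K] [∀ l, Module.Finite K (N l)] {L : ℕ}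
    (hgen : ∀ l, L ≤ l → ⨆ k, LinearMap.range (T k l) = ⊤)
    (hsoc : ∀ l (x : N l), (∀ k, T k l x = 0) → x = 0)
    {W : Submodule K (Fin n → K)} (hW : W ≠ ⊤) :
    ∃ w, w ∉ W ∧ ∀ l, Function.Injective (comb T w l) := by
  classical
  obtain ⟨φ, h1, h2⟩ := exists_graded_action hT
  let : Module (MvPolynomial (Fin n) K) (⨁ l, N l) := Module.compHom _ φ.toRingHom
  have hsmul : ∀ (p : MvPolynomial (Fin n) K) (x : ⨁ l, N l), p • x = φ p x := fun _ _ => rfl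
  have hnoeth : IsNoetherian (MvPolynomial (Fin n) K) (⨁ l, N l) :=
    isNoetherian_directSum hgen φ h1
  have hfin := associatedPrimes.finite (MvPolynomial (Fin n) K) (⨁ l, N l)
  let lin : (Fin n → K) →ₗ[K] MvPolynomial (Fin n) K :=
    Fintype.linearCombination K (fun k : Fin n => (X k : MvPolynomial (Fin n) K))
  let sub : Ideal (MvPolynomial (Fin n) K) → Subspace K (Fin n → K) :=
    fun p => (p.restrictScalars K).comap lin
  have hsub : ∀ p ∈ associatedPrimes (MvPolynomial (Fin n) K) (⨁ l, N l), sub p ≠ ⊤ := by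
    intro p hp htop
    obtain ⟨hprime, x, hx⟩ := Submodule.isAssociatedPrime_iff.1 hp
    have hX : ∀ k, φ (X k) x = 0 := by
      intro k
      have hk : (Pi.single k 1 : Fin n → K) ∈ sub p := htop ▸ Submodule.mem_top
      have hk' : lin (Pi.single k 1) ∈ p := hk
      rw [hx, Submodule.mem_colon_singleton, Submodule.mem_bot, hsmul] at hk'
      simpa [lin] using hk'
    have hx0 : x = 0 := by
      refine DFinsupp.ext fun l => ?_
      refine hsoc l _ fun k => ?_
      change T k l (x l) = 0
      rw [← h2, hX]
      rfl
    refine hprime.ne_top ((Ideal.eq_top_iff_one _).2 ?_)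
    rw [hx, Submodule.mem_colon_singleton, hx0, smul_zero]
    exact Submodule.zero_mem _
  have hun := Subspace.biUnion_ne_univ_of_top_notMem
    (s := insert W (hfin.toFinset.image sub)) (by
      intro h
      rcases Finset.mem_insert.1 h with h | h
      · exact hW h.symm
      · obtain ⟨p, hp, hp'⟩ := Finset.mem_image.1 h
        exact hsub p (hfin.mem_toFinset.1 hp) hp')
  obtain ⟨w, hw⟩ := (Set.ne_univ_iff_exists_notMem _).1 hun
  simp only [Set.mem_iUnion, not_exists] at hw
  refine ⟨w, hw W (Finset.mem_insert_self _ _), fun l => ?_⟩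
  have hreg : lin w ∈ {r | IsSMulRegular (⨁ l, N l) r} := by
    by_contra hcon
    have : lin w ∈ ⋃ p ∈ associatedPrimes (MvPolynomial (Fin n) K) (⨁ l, N l),
        (p : Set (MvPolynomial (Fin n) K)) := by
      rw [biUnion_associatedPrimes_eq_compl_regular]
      exact hcon
    simp only [Set.mem_iUnion] at this
    obtain ⟨p, hp, hp'⟩ := this
    exact hw (sub p) (Finset.mem_insert_of_mem
      (Finset.mem_image_of_mem _ (hfin.mem_toFinset.2 hp))) hp'
  have hcomb : ∀ x : N l, lin w • lof K ℕ N l x = lof K ℕ N (l + 1) (comb T w l x) := by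
    intro x
    rw [hsmul, comb_apply, map_sum]
    simp only [lin, Fintype.linearCombination_apply, map_sum, LinearMap.sum_apply, map_smul,
      LinearMap.smul_apply, h1]
  rw [injective_iff_map_eq_zero]
  intro x hx
  have h0 : lin w • lof K ℕ N l x = lin w • 0 := by
    rw [hcomb, hx, map_zero, smul_zero]
  have := hreg h0
  have h3 := lof_apply (R := K) (M := N) l x
  rw [this] at h3
  exact h3.symm

include hT in
/-- A generic combination of the operators, chosen outside of a given proper subspace of the
coefficients, is injective in all large degrees. -/
theorem exists_comb_injective [Infinite K] [∀ l, Module.Finite K (N l)] {L : ℕ}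
    (hgen : ∀ l, L ≤ l → ⨆ k, LinearMap.range (T k l) = ⊤)
    {W : Submodule K (Fin n → K)} (hW : W ≠ ⊤) :
    ∃ w, w ∉ W ∧ ∃ l₁, ∀ l, l₁ ≤ l → Function.Injective (comb T w l) := by
  obtain ⟨k₀, hk₀⟩ := exists_socle_eq_zero hT hgen
  obtain ⟨w, hw, hw'⟩ := exists_comb_injective_of_socle (N := fun l => N (k₀ + l))
    (T := fun k l => T k (k₀ + l)) (fun i j l x => hT i j (k₀ + l) x)
    (L := L) (fun l hl => hgen (k₀ + l) (by omega)) (fun l x => hk₀ (k₀ + l) (by omega) x) hW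
  refine ⟨w, hw, k₀, fun l hl => ?_⟩
  obtain ⟨m, rfl⟩ := Nat.exists_eq_add_of_le hl
  exact hw' m

end Generic

/-! ### Quasiregular bases over an infinite field -/

section Comb

variable {R : Type*} [CommRing R] {N : ℕ → Type*} [∀ l, AddCommGroup (N l)]
  [∀ l, Module R (N l)] {n : ℕ} {T : Fin n → ∀ l, N l →ₗ[R] N (l + 1)}
  (hT : ∀ i j l (x : N l), T i (l + 1) (T j l x) = T j (l + 1) (T i l x))

include hT in
theorem apply_comb (k : Fin n) (w : Fin n → R) (l : ℕ) (x : N l) :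
    T k (l + 1) (comb T w l x) = comb T w (l + 1) (T k l x) := by
  simp only [comb_apply, map_sum, map_smul, hT k]

include hT in
theorem comb_comb (w w' : Fin n → R) (l : ℕ) (x : N l) :
    comb T w (l + 1) (comb T w' l x) = comb T w' (l + 1) (comb T w l x) := by
  rw [comb_apply, comb_apply T w l, map_sum]
  refine Finset.sum_congr rfl fun k _ => ?_
  rw [apply_comb hT, map_smul]

end Comb

section Field

variable {K : Type*} [Field K] {N : ℕ → Type*} [∀ l, AddCommGroup (N l)]
  [∀ l, Module K (N l)] {n : ℕ} {T : Fin n → ∀ l, N l →ₗ[K] N (l + 1)}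
  (hT : ∀ i j l (x : N l), T i (l + 1) (T j l x) = T j (l + 1) (T i l x))

include hT in
/-- A generic choice of constant vectors of coefficients is quasiregular in all large degrees: the
next vector is chosen generically for the graded quotient by the images of the preceding operators,
and outside of the span of the preceding vectors. -/
theorem exists_quasiregular_family [Infinite K] [∀ l, Module.Finite K (N l)] {L : ℕ}
    (hgen : ∀ l, L ≤ l → ⨆ k, LinearMap.range (T k l) = ⊤) (i : ℕ) (hi : i ≤ n) :
    ∃ v : ℕ → Fin n → K, LinearIndependent K (fun j : Fin i => v j) ∧
      ∃ l₁, ∀ j < i, ∀ l, l₁ ≤ l → ∀ x : N (l + 1),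
        comb T (v j) (l + 1) x ∈ imageSum (fun j => comb T (v j)) j (l + 1) →
          x ∈ imageSum (fun j => comb T (v j)) j l := by
  induction i with
  | zero => exact ⟨0, linearIndependent_empty_type, 0, fun j hj => absurd hj (Nat.not_lt_zero j)⟩
  | succ i ih =>
    obtain ⟨v, hv, l₁, hl₁⟩ := ih (by omega)
    let C : ∀ l, Submodule K (N (l + 1)) := fun l => imageSum (fun j => comb T (v j)) i l
    have hC : ∀ k l, C l ≤ (C (l + 1)).comap (T k (l + 1)) := by
      intro k l
      refine imageSum_le_iff.2 fun j hj x => ?_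
      rw [Submodule.mem_comap, apply_comb hT]
      exact apply_mem_imageSum (T := fun j => comb T (v j)) hj _
    let Tq : Fin n → ∀ l, (N (l + 1) ⧸ C l) →ₗ[K] (N (l + 1 + 1) ⧸ C (l + 1)) :=
      fun k l => Submodule.mapQ (C l) (C (l + 1)) (T k (l + 1)) (hC k l)
    have hW : Submodule.span K (Set.range (fun j : Fin i => v j)) ≠ ⊤ := by
      intro htop
      have h1 := finrank_range_le_card (R := K) (fun j : Fin i => v j)
      rw [Set.finrank, htop, finrank_top, Module.finrank_fin_fun, Fintype.card_fin] at h1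
      omega
    obtain ⟨w, hw, l₂, hl₂⟩ := exists_comb_injective (N := fun l => N (l + 1) ⧸ C l) (T := Tq)
      (by
        rintro a b l ⟨x⟩
        exact congrArg (Submodule.Quotient.mk (p := C (l + 1 + 1))) (hT a b (l + 1) x))
      (L := L) (by
        intro l hl
        have h1 := congrArg (Submodule.map (C (l + 1)).mkQ) (hgen (l + 1) (by omega))
        rw [Submodule.map_iSup, Submodule.map_top, Submodule.range_mkQ] at h1
        refine top_le_iff.1 (h1.symm.le.trans (iSup_mono fun k => ?_))
        rintro _ ⟨_, ⟨x, rfl⟩, rfl⟩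
        exact ⟨Submodule.Quotient.mk x, rfl⟩) hW
    have hcongr : ∀ j ≤ i, ∀ l, imageSum (fun j => comb T (Function.update v i w j)) j l =
        imageSum (fun j => comb T (v j)) j l := by
      intro j hj l
      refine imageSum_congr fun k hk => ?_
      rw [Function.update_of_ne (by omega)]
    refine ⟨Function.update v i w, ?_, max l₁ l₂, fun j hj l hl x hx => ?_⟩
    · rw [linearIndependent_finSucc']
      have h1 : (Fin.init fun j : Fin (i + 1) => Function.update v i w j) =
          fun j : Fin i => v j := by
        funext j
        simp only [Fin.init, Fin.val_castSucc]
        rw [Function.update_of_ne (by have := j.2; omega)]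
      rw [h1]
      refine ⟨hv, ?_⟩
      simpa using hw
    · rw [hcongr j (by omega)] at hx ⊢
      rcases Nat.lt_succ_iff_lt_or_eq.1 hj with hj' | rfl
      · rw [Function.update_of_ne (by omega)] at hx
        exact hl₁ j hj' l (by omega) x hx
      · rw [Function.update_self] at hx
        have h1 : comb Tq w l (Submodule.Quotient.mk x) = 0 := by
          have h2 : comb Tq w l (Submodule.Quotient.mk x) =
              Submodule.Quotient.mk (comb T w (l + 1) x) := by
            rw [comb_apply, comb_apply, ← Submodule.mkQ_apply, ← Submodule.mkQ_apply, map_sum]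
            rfl
          rw [h2]
          exact (Submodule.Quotient.mk_eq_zero _).2 hx
        have h3 := (injective_iff_map_eq_zero _).1 (hl₂ l (by omega)) _ h1
        exact (Submodule.Quotient.mk_eq_zero _).1 h3

/-! ### Bases adapted to a quasiregular family -/

/-- A basis of `B` modulo `A`, lifted to the ambient space. -/
theorem exists_fin_sup_span_eq {V : Type*} [AddCommGroup V] [Module K V] [Module.Finite K V]
    {A B : Submodule K V} (hAB : A ≤ B) :
    ∃ b : Fin (Module.finrank K B - Module.finrank K A) → V,
      B = A ⊔ Submodule.span K (Set.range b) := by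
  obtain ⟨D, hD⟩ := Submodule.exists_isCompl (A.submoduleOf B)
  have hdim : Module.finrank K D = Module.finrank K B - Module.finrank K A := by
    have h1 := Submodule.finrank_add_eq_of_isCompl hD
    have h2 : Module.finrank K (A.submoduleOf B) = Module.finrank K A :=
      (Submodule.submoduleOfEquivOfLe hAB).finrank_eq
    omega
  let e := Module.finBasisOfFinrankEq K D hdim
  refine ⟨fun s => ((e s : D) : B), ?_⟩
  have h1 : Submodule.span K (Set.range fun s => (((e s : D) : B) : V)) = D.map B.subtype := by
    have h2 : (Set.range fun s => (((e s : D) : B) : V)) =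
        B.subtype '' (D.subtype '' Set.range e) := by
      rw [← Set.range_comp, ← Set.range_comp]
      rfl
    rw [h2, Submodule.span_image, Submodule.span_image, e.span_eq, Submodule.map_top,
      Submodule.range_subtype]
  rw [h1]
  have h3 : A = (A.submoduleOf B).map B.subtype := by
    rw [Submodule.submoduleOf, Submodule.map_comap_subtype, inf_eq_right.2 hAB]
  conv_rhs => rw [h3]
  rw [← Submodule.map_sup, hD.sup_eq_top, Submodule.map_top, Submodule.range_subtype]

section Adapted

variable {Z : ℕ → ∀ l, N l →ₗ[K] N (l + 1)}
  (hZ : ∀ i j l (x : N l), Z i (l + 1) (Z j l x) = Z j (l + 1) (Z i l x))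
  [∀ l, Module.Finite K (N l)]

/-- The dimension of the component `N_{l+1}` modulo the images of the first `j` operators. -/
noncomputable def codim (Z : ℕ → ∀ l, N l →ₗ[K] N (l + 1)) (j l : ℕ) : ℕ :=
  Module.finrank K (N (l + 1)) - Module.finrank K (imageSum Z j l)

theorem finrank_imageSum_mono {i j : ℕ} (hij : i ≤ j) (l : ℕ) :
    Module.finrank K (imageSum Z i l) ≤ Module.finrank K (imageSum Z j l) :=
  Submodule.finrank_mono (imageSum_mono hij l)

omit [∀ l, Module.Finite K (N l)] in
theorem sum_Ico_sub_of_monotone {f : ℕ → ℕ} (hf : Monotone f) {j n : ℕ} (hj : j ≤ n) :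
    ∑ k ∈ Finset.Ico j n, (f (k + 1) - f k) = f n - f j := by
  induction n, hj using Nat.le_induction with
  | base => simp
  | succ n hn ih =>
    rw [Finset.sum_Ico_succ_top hn, ih]
    have h1 := hf hn
    have h2 := hf (Nat.le_succ n)
    simp only [Nat.succ_eq_add_one] at h2
    omega

include hZ in
/-- By quasiregularity the operator `Z_j` maps `N_{l+1}` modulo the first `j` images isomorphically
onto the quotient of two successive image sums in the next degree. -/
theorem finrank_imageSum_succ {j l : ℕ}
    (hq : ∀ x : N (l + 1), Z j (l + 1) x ∈ imageSum Z j (l + 1) → x ∈ imageSum Z j l) :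
    Module.finrank K (imageSum Z (j + 1) (l + 1)) - Module.finrank K (imageSum Z j (l + 1)) =
      codim Z j l := by
  set g : N (l + 1) →ₗ[K] (N (l + 1 + 1) ⧸ imageSum Z j (l + 1)) :=
    (imageSum Z j (l + 1)).mkQ.comp (Z j (l + 1)) with hg
  have hker : LinearMap.ker g = imageSum Z j l := by
    ext x
    rw [LinearMap.mem_ker, hg, LinearMap.comp_apply, Submodule.mkQ_apply,
      Submodule.Quotient.mk_eq_zero]
    exact ⟨hq x, apply_mem_imageSum_succ hZ j j⟩
  have hrange : LinearMap.range g =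
      (imageSum Z (j + 1) (l + 1)).map (imageSum Z j (l + 1)).mkQ := by
    rw [imageSum_succ, Submodule.map_sup, hg, LinearMap.range_comp, Submodule.mkQ_map_self,
      bot_sup_eq]
  have h1 := LinearMap.finrank_range_add_finrank_ker g
  have h2 := LinearMap.finrank_range_add_finrank_ker
    ((imageSum Z j (l + 1)).mkQ.domRestrict (imageSum Z (j + 1) (l + 1)))
  rw [LinearMap.range_domRestrict, LinearMap.ker_domRestrict, Submodule.ker_mkQ, ← hrange] at h2
  have h3 : Module.finrank K
      ((imageSum Z j (l + 1)).submoduleOf (imageSum Z (j + 1) (l + 1))) =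
        Module.finrank K (imageSum Z j (l + 1)) :=
    (Submodule.submoduleOfEquivOfLe (imageSum_mono (Nat.le_succ j) (l + 1))).finrank_eq
  rw [hker] at h1
  rw [Submodule.submoduleOf] at h3
  rw [codim]
  omega

include hZ in
/-- The codimensions of the image sums in successive degrees satisfy the same recursion as the numbers
of generators for which a given variable is multiplicative, see `ClassedType.count_next`. -/
theorem codim_succ {n l : ℕ} (hgen : imageSum Z n (l + 1) = ⊤)
    (hq : ∀ j < n, ∀ x : N (l + 1),
      Z j (l + 1) x ∈ imageSum Z j (l + 1) → x ∈ imageSum Z j l) {j : ℕ} (hj : j ≤ n) :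
    codim Z j (l + 1) = ∑ k ∈ Finset.Ico j n, codim Z k l := by
  rw [← Finset.sum_congr rfl fun k hk =>
      finrank_imageSum_succ hZ (hq k (Finset.mem_Ico.1 hk).2),
    sum_Ico_sub_of_monotone (f := fun k => Module.finrank K (imageSum Z k (l + 1)))
      (fun a b hab => finrank_imageSum_mono hab _) hj, hgen, finrank_top]
  rfl

include hZ in
/-- A quasiregular family has a finite set of generators with multiplicative variables such that the
multiplicative products of degree one span, and the multiplicative products of any positive degree
are as many as the dimension of the component. -/
theorem exists_classedType {n l₁ : ℕ} (hgen : ∀ l, l₁ ≤ l → imageSum Z n l = ⊤)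
    (hq : ∀ j < n, ∀ l, l₁ ≤ l → ∀ x : N (l + 1),
      Z j (l + 1) x ∈ imageSum Z j (l + 1) → x ∈ imageSum Z j l) :
    ∃ (X : ClassedType) (e : X.B → N (l₁ + 1)),
      ⊤ ≤ Submodule.span K (Set.range (nextFamily Z e)) ∧
      ∀ m, Fintype.card (X.nextIter (m + 1)).B = Module.finrank K (N (l₁ + 1 + m + 1)) := by
  choose b hb using fun j => exists_fin_sup_span_eq (imageSum_mono (T := Z) (Nat.le_succ j) l₁)
  let d : ℕ → ℕ := fun j => Module.finrank K (imageSum Z j.succ l₁) -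
    Module.finrank K (imageSum Z j l₁)
  let X : ClassedType :=
    { B := Σ c : Fin n, Fin (d c)
      mult := fun p => p.1 + 1 }
  let e : X.B → N (l₁ + 1) := fun p => b p.1 p.2
  have hX : ∀ p, X.mult p ≤ n := fun p => p.1.2
  refine ⟨X, e, ?_, fun m => ?_⟩
  · -- the component of degree `l₁ + 1` modulo the first `j` images is spanned by the generators
    -- for which the variable `j` is multiplicative
    have h1 : ∀ j k, j ≤ k → k ≤ n → imageSum Z k l₁ ≤ imageSum Z j l₁ ⊔
        Submodule.span K (e '' {p | j < X.mult p}) := by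
      intro j k hjk
      induction k, hjk using Nat.le_induction with
      | base => exact fun _ => le_sup_left
      | succ k hk ih =>
        intro hkn
        rw [show imageSum Z (k + 1) l₁ = _ from hb k]
        refine sup_le (ih (by omega)) (le_sup_of_le_right (Submodule.span_mono ?_))
        rintro _ ⟨s, rfl⟩
        exact ⟨⟨⟨k, hkn⟩, s⟩, Nat.lt_succ_of_le hk, rfl⟩
    have h2 : ∀ j ≤ n, imageSum Z j (l₁ + 1) ≤
        Submodule.span K (Set.range (nextFamily Z e)) := by
      intro j
      induction j with
      | zero => exact fun _ => by rw [imageSum_zero]; exact bot_le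
      | succ j ih =>
        intro hj
        rw [imageSum_succ]
        refine sup_le (ih (by omega)) ?_
        have h3 := h1 j n (by omega) le_rfl
        rw [hgen l₁ le_rfl] at h3
        rw [LinearMap.range_eq_map]
        refine (Submodule.map_mono h3).trans ?_
        rw [Submodule.map_sup, Submodule.map_span]
        refine sup_le ?_ (Submodule.span_le.2 ?_)
        · rintro _ ⟨x, hx, rfl⟩
          exact ih (by omega) (apply_mem_imageSum_succ hZ j j hx)
        · rintro _ ⟨_, ⟨p, hp, rfl⟩, rfl⟩
          exact Submodule.subset_span ⟨⟨p, ⟨j, hp⟩⟩, rfl⟩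
    rw [← hgen (l₁ + 1) (by omega)]
    exact h2 n le_rfl
  · have hcount : ∀ m, ∀ j ≤ n, (X.nextIter m).count j = codim Z j (l₁ + m) := by
      intro m
      induction m with
      | zero =>
        intro j hj
        have h1 : X.count j = ∑ k ∈ Finset.Ico j n, d k := by
          have h2 : X.count j = ∑ c : Fin n, ∑ _s : Fin (d c), if j < (c : ℕ) + 1 then 1 else 0 := by
            change ∑ p : (Σ c : Fin n, Fin (d c)), (if j < (p.1 : ℕ) + 1 then 1 else 0) = _
            rw [Fintype.sum_sigma]
          rw [h2, Finset.sum_congr rfl (fun c _ => Finset.sum_const _)]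
          simp only [Finset.card_univ, Fintype.card_fin, smul_eq_mul]
          rw [Fin.sum_univ_eq_sum_range (fun c => d c * if j < c + 1 then 1 else 0)]
          simp only [mul_ite, mul_one, mul_zero]
          rw [← Finset.sum_filter]
          refine Finset.sum_congr ?_ fun _ _ => rfl
          ext k
          simp only [Finset.mem_filter, Finset.mem_range, Finset.mem_Ico]
          omega
        have h3 := sum_Ico_sub_of_monotone
          (f := fun k => Module.finrank K (imageSum Z k l₁))
          (fun a b hab => finrank_imageSum_mono hab _) hj
        rw [hgen l₁ le_rfl, finrank_top] at h3
        exact h1.trans h3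
      | succ m ih =>
        intro j hj
        change (X.nextIter m).next.count j = codim Z j (l₁ + m + 1)
        rw [ClassedType.count_next (ClassedType.mult_nextIter_le hX m),
          codim_succ hZ (hgen _ (by omega)) (fun j hj => hq j hj _ (by omega)) hj]
        exact Finset.sum_congr rfl fun k hk => ih k (Finset.mem_Ico.1 hk).2.le
    change Fintype.card (X.nextIter m).next.B = _
    rw [ClassedType.card_next (ClassedType.mult_nextIter_le hX m),
      Finset.sum_congr rfl fun k hk => hcount m k (Finset.mem_range.1 hk).le,
      Finset.range_eq_Ico, ← codim_succ hZ (hgen _ (by omega))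
        (fun j hj => hq j hj _ (by omega)) (Nat.zero_le n)]
    rw [codim, imageSum_zero, finrank_bot, Nat.sub_zero, Nat.add_right_comm l₁ 1 m]

end Adapted

end Field

/-! ### Generators over a ring from generators over a residue field -/

section Lift

open TensorProduct

variable {R K : Type*} [CommRing R] [Field K] {N : ℕ → Type*} [∀ l, AddCommGroup (N l)]
  [∀ l, Module R (N l)]

/-- Elements which generate a finite free module over the residue field `K` generate it up to a
multiple by an element of residue one, by Nakayama's lemma. -/
theorem exists_smul_mem_span_of_tmul {M : Type*} [AddCommGroup M] [Module R M] [Module.Finite R M]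
    [Module.Free R M] [Algebra R K] (hK : Function.Surjective (algebraMap R K))
    {S : Set M} (hS : ⊤ ≤ Submodule.span K ((fun x : M => (1 : K) ⊗ₜ[R] x) '' S)) :
    ∃ g : R, algebraMap R K g = 1 ∧ ∀ x : M, g • x ∈ Submodule.span R S := by
  have hker : ∀ x : M, (1 : K) ⊗ₜ[R] x = 0 →
      x ∈ RingHom.ker (algebraMap R K) • (⊤ : Submodule R M) := by
    intro x hx
    let b := Module.Free.chooseBasis R M
    rw [← b.sum_repr x]
    refine Submodule.sum_mem _ fun i _ => Submodule.smul_mem_smul ?_ Submodule.mem_top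
    have h1 := Module.Basis.baseChange_repr_tmul K b 1 x i
    rw [hx, map_zero, Finsupp.zero_apply, Algebra.smul_def, mul_one] at h1
    exact h1.symm
  have hspan : ∀ y ∈ Submodule.span K ((fun x : M => (1 : K) ⊗ₜ[R] x) '' S),
      ∃ z ∈ Submodule.span R S, (1 : K) ⊗ₜ[R] z = y := by
    intro y hy
    induction hy using Submodule.span_induction with
    | mem y hy =>
      obtain ⟨z, hz, rfl⟩ := hy
      exact ⟨z, Submodule.subset_span hz, rfl⟩
    | zero => exact ⟨0, Submodule.zero_mem _, tmul_zero _ _⟩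
    | add y y' _ _ h h' =>
      obtain ⟨z, hz, rfl⟩ := h
      obtain ⟨z', hz', rfl⟩ := h'
      exact ⟨z + z', Submodule.add_mem _ hz hz', tmul_add _ _ _⟩
    | smul a y _ h =>
      obtain ⟨z, hz, rfl⟩ := h
      obtain ⟨r, rfl⟩ := hK a
      refine ⟨r • z, Submodule.smul_mem _ _ hz, ?_⟩
      rw [tmul_smul, algebraMap_smul]
  obtain ⟨g, hg, hg'⟩ := Submodule.exists_sub_one_mem_and_smul_le_of_fg_of_le_sup
    (I := RingHom.ker (algebraMap R K)) (N := Submodule.span R S)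
    (Module.Finite.fg_top (R := R) (M := M)) le_rfl (by
      intro x _
      obtain ⟨z, hz, hz'⟩ := hspan _ (hS (Submodule.mem_top (x := (1 : K) ⊗ₜ[R] x)))
      rw [← add_sub_cancel z x]
      refine Submodule.add_mem_sup hz (hker _ ?_)
      rw [tmul_sub, hz', sub_self])
  refine ⟨g, ?_, fun x => hg' (Submodule.smul_mem_pointwise_smul x g ⊤ Submodule.mem_top)⟩
  rw [RingHom.mem_ker, map_sub, map_one] at hg
  exact sub_eq_zero.1 hg

/-- Over a ring `R` with a residue field `K` and constants `c : K → R`, the generators and the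
coefficients found over `K` lift to `R`. The products of degree one span the next component up to
multiplication by some `g` of residue one, and the number of products of each positive degree is the
rank of the component. -/
theorem exists_classedType_of_residue [Infinite K] (ev : R →+* K) (c : K →+* R)
    (hc : ∀ a, ev (c a) = a) [∀ l, Module.Finite R (N l)] [∀ l, Module.Free R (N l)] {n : ℕ}
    {T : Fin n → ∀ l, N l →ₗ[R] N (l + 1)}
    (hT : ∀ i j l (x : N l), T i (l + 1) (T j l x) = T j (l + 1) (T i l x)) {L : ℕ}
    (hgen : ∀ l, L ≤ l → ⨆ k, LinearMap.range (T k l) = ⊤) :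
    ∃ v : ℕ → Fin n → K, LinearIndependent K (fun j : Fin n => v j) ∧
      ∃ (l₀ : ℕ) (_ : L ≤ l₀) (X : ClassedType) (e : X.B → N l₀) (g : R), ev g = 1 ∧
        (∀ x : N (l₀ + 1), g • x ∈ Submodule.span R
          (Set.range (nextFamily (fun j => comb T fun k => c (v j k)) e))) ∧
        ∀ m, Fintype.card (X.nextIter (m + 1)).B = Module.finrank R (N (l₀ + m + 1)) := by
  have : Nontrivial R := ev.domain_nontrivial
  let _ : Algebra R K := ev.toAlgebra
  have hsurj : Function.Surjective (algebraMap R K) := fun a => ⟨c a, hc a⟩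
  let TK : Fin n → ∀ l, (K ⊗[R] N l) →ₗ[K] (K ⊗[R] N (l + 1)) :=
    fun k l => (T k l).baseChange K
  have hTK : ∀ i j l (x : K ⊗[R] N l), TK i (l + 1) (TK j l x) = TK j (l + 1) (TK i l x) := by
    intro i j l x
    induction x using TensorProduct.induction_on with
    | zero => simp only [map_zero]
    | tmul a x => simp only [TK, LinearMap.baseChange_tmul, hT i j]
    | add x y hx hy => simp only [map_add, hx, hy]
  have hgenK : ∀ l, L ≤ l → ⨆ k, LinearMap.range (TK k l) = ⊤ := by
    intro l hl
    refine top_le_iff.1 fun x _ => ?_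
    induction x using TensorProduct.induction_on with
    | zero => exact Submodule.zero_mem _
    | tmul a x =>
      have hx : x ∈ ⨆ k, LinearMap.range (T k l) := hgen l hl ▸ Submodule.mem_top
      induction hx using Submodule.iSup_induction' with
      | mem k y hy =>
        obtain ⟨z, rfl⟩ := hy
        exact Submodule.mem_iSup_of_mem k ⟨a ⊗ₜ z, LinearMap.baseChange_tmul _ _ _⟩
      | zero => rw [tmul_zero]; exact Submodule.zero_mem _
      | add y z _ _ h1 h2 => rw [tmul_add]; exact Submodule.add_mem _ (h1 trivial) (h2 trivial)
    | add x y hx hy => exact Submodule.add_mem _ (hx trivial) (hy trivial)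
  obtain ⟨v, hv, l₁, hl₁⟩ := exists_quasiregular_family hTK hgenK n le_rfl
  have hcombgen : ∀ l, L ≤ l → imageSum (fun j => comb TK (v j)) n l = ⊤ := by
    intro l hl
    rw [← hgenK l hl]
    refine le_antisymm (imageSum_le_iff.2 fun j _ x => ?_) (iSup_le fun k => ?_)
    · rw [comb_apply]
      exact Submodule.sum_mem _ fun k _ => Submodule.smul_mem _ _
        (Submodule.mem_iSup_of_mem k (LinearMap.mem_range_self _ _))
    · -- every operator is a combination of the operators of the basis `v`
      rintro _ ⟨x, rfl⟩
      have hspan := hv.span_eq_top_of_card_eq_finrank' (by simp)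
      have hmem : (Pi.single k 1 : Fin n → K) ∈
          Submodule.span K (Set.range fun j : Fin n => v j) := hspan ▸ Submodule.mem_top
      have hcomb : ∀ w ∈ Submodule.span K (Set.range fun j : Fin n => v j),
          comb TK w l x ∈ imageSum (fun j => comb TK (v j)) n l := by
        intro w hw
        induction hw using Submodule.span_induction with
        | mem w hw =>
          obtain ⟨j, rfl⟩ := hw
          exact apply_mem_imageSum (T := fun j => comb TK (v j)) j.2 x
        | zero =>
          rw [comb_apply]
          simp only [Pi.zero_apply, zero_smul, Finset.sum_const_zero]
          exact Submodule.zero_mem _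
        | add w w' _ _ h h' =>
          have h1 : comb TK (w + w') l x = comb TK w l x + comb TK w' l x := by
            simp only [comb_apply, Pi.add_apply, add_smul, Finset.sum_add_distrib]
          rw [h1]
          exact Submodule.add_mem _ h h'
        | smul a w _ h =>
          have h1 : comb TK (a • w) l x = a • comb TK w l x := by
            simp only [comb_apply, Pi.smul_apply, smul_eq_mul, mul_smul, Finset.smul_sum]
          rw [h1]
          exact Submodule.smul_mem _ _ h
      have h2 := hcomb _ hmem
      rw [comb_apply, Finset.sum_eq_single k (fun j _ hj => by
        rw [Pi.single_eq_of_ne hj, zero_smul]) (by simp), Pi.single_eq_same, one_smul] at h2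
      exact h2
  obtain ⟨X, e, he, hcard⟩ := exists_classedType (Z := fun j => comb TK (v j))
    (fun i j l x => comb_comb hTK (v i) (v j) l x) (l₁ := max L l₁)
    (fun l hl => hcombgen l (le_trans (le_max_left _ _) hl))
    (fun j hj l hl x hx => hl₁ j hj l (le_trans (le_max_right _ _) hl) x hx)
  choose e' he' using fun b => TensorProduct.mk_surjective R (N (max L l₁ + 1)) K hsurj (e b)
  have hnext : ∀ p, nextFamily (fun j => comb TK (v j)) e p =
      (1 : K) ⊗ₜ[R] nextFamily (fun j => comb T fun k => c (v j k)) e' p := by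
    intro p
    change comb TK (v p.2) _ (e p.1) = 1 ⊗ₜ[R] comb T (fun k => c (v p.2 k)) _ (e' p.1)
    rw [← he', comb_apply, comb_apply, tmul_sum]
    refine Finset.sum_congr rfl fun k _ => ?_
    rw [tmul_smul, ← algebraMap_smul K (c (v p.2 k)), show algebraMap R K (c (v p.2 k)) = _ from
      hc _]
    rfl
  obtain ⟨g, hg, hg'⟩ := exists_smul_mem_span_of_tmul hsurj
    (S := Set.range (nextFamily (fun j => comb T fun k => c (v j k)) e')) (by
      rw [← Set.range_comp]
      refine he.trans (Submodule.span_mono ?_)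
      rintro _ ⟨p, rfl⟩
      exact ⟨p, (hnext p).symm⟩)
  refine ⟨v, hv, max L l₁ + 1, by omega, X, e', g, hg, hg', fun m => ?_⟩
  rw [hcard m, Module.finrank_baseChange]

end Lift

open TopologicalSpace

variable {ι : Type*} {U V : Opens (ι → ℝ)}

/-! ### Commutators of vector fields -/

theorem differential_sub (f g : Fn V) :
    differential (f - g) = differential f - differential g := by
  rw [eq_sub_iff_add_eq, ← differential_add, sub_add_cancel]

theorem smul_monomialForm (f g : Fn V) (i : ι) :
    f • monomialForm i g = monomialForm (V := V) i (f * g) := by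
  rw [← smul_eq_mul, map_smul]

theorem lieDeriv_monomialForm (Z : VField V) (i : ι) (f : Fn V) :
    lieDeriv Z (monomialForm i f) = monomialForm i (act Z f) + f • differential (Z i) := by
  rw [lieDeriv, contractDiff_single, pairing_monomialForm, differential_mul]
  abel

theorem act_add_left (X Y : VField V) (f : Fn V) : act (X + Y) f = act X f + act Y f :=
  pairing_add_left X Y _

theorem act_smul_left (f : Fn V) (X : VField V) (g : Fn V) : act (f • X) g = f * act X g :=
  pairing_smul_left f X _

theorem lieDeriv_add_left (X Y : VField V) (φ : Form V) :
    lieDeriv (X + Y) φ = lieDeriv X φ + lieDeriv Y φ := by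
  induction φ using form_induction with
  | zero => simp [lieDeriv_zero]
  | add φ ψ h₁ h₂ =>
    rw [lieDeriv_add, lieDeriv_add, lieDeriv_add, h₁, h₂]
    abel
  | single i f =>
    rw [lieDeriv_monomialForm, lieDeriv_monomialForm, lieDeriv_monomialForm, act_add_left,
      Pi.add_apply, differential_add, map_add, smul_add]
    abel

theorem lieDeriv_smul_left (f : Fn V) (X : VField V) (φ : Form V) :
    lieDeriv (f • X) φ = f • lieDeriv X φ + pairing X φ • differential f := by
  induction φ using form_induction with
  | zero => simp [lieDeriv_zero]
  | add φ ψ h₁ h₂ =>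
    rw [lieDeriv_add, lieDeriv_add, map_add, h₁, h₂]
    module
  | single i g =>
    rw [lieDeriv_monomialForm, lieDeriv_monomialForm, act_smul_left, Pi.smul_apply, smul_eq_mul,
      differential_mul, pairing_monomialForm, ← smul_monomialForm]
    module

/-- Mixed partial derivatives commute. -/
theorem partialDeriv_comm (i j : ι) (f : Fn V) :
    partialDeriv i (partialDeriv j f) = partialDeriv j (partialDeriv i f) := by
  classical
  obtain ⟨s, g, hg, hfg⟩ := f.2
  refine Subtype.ext (funext fun x => ?_)
  have hopen := isOpen_restrict_image V s
  let e : ι → (s → ℝ) := fun i k => if (k : ι) = i then 1 else 0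
  have hg1 : ∀ i, ContDiffOn ℝ (⊤ : ℕ∞) (fun y => fderiv ℝ g y (e i))
      (s.restrict '' (V : Set (ι → ℝ))) := fun i =>
    (hg.fderiv_of_isOpen hopen (by simp)).clm_apply contDiffOn_const
  have hx : s.restrict '' (V : Set (ι → ℝ)) ∈ nhds (s.restrict (x : ι → ℝ)) :=
    hopen.mem_nhds ⟨x, x.2, rfl⟩
  have hsnd : DifferentiableAt ℝ (fderiv ℝ g) (s.restrict (x : ι → ℝ)) :=
    ((hg.fderiv_of_isOpen (m := (⊤ : ℕ∞)) hopen (by simp)).contDiffAt hx).differentiableAt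
      (by simp)
  have key : ∀ i j, partialFun i (partialDeriv j f).1 x =
      fderiv ℝ (fderiv ℝ g) (s.restrict (x : ι → ℝ)) (e i) (e j) := by
    intro i j
    refine (partialFun_eq (hg1 j) (fun x => partialFun_eq hg hfg j x) i x).trans ?_
    rw [fderiv_clm_apply hsnd (differentiableAt_const _)]
    simp [e]
  have hsymm : IsSymmSndFDerivAt ℝ g (s.restrict (x : ι → ℝ)) :=
    (hg.contDiffAt hx).isSymmSndFDerivAt (by
      rw [minSmoothness_of_isRCLikeNormedField]
      exact WithTop.coe_le_coe.2 le_top)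
  exact (key i j).trans ((hsymm (e i) (e j)).trans (key j i).symm)

theorem partialDeriv_zero (i : ι) : partialDeriv i (0 : Fn V) = 0 := by
  have h := partialDeriv_add i (0 : Fn V) 0
  rw [add_zero] at h
  exact left_eq_add.mp h

/-- The coefficient of `dhʲ`. -/
def coeff (j : ι) : Form V →ₗ[Fn V] Fn V := Finsupp.lapply (R := Fn V) j

theorem form_ext {φ ψ : Form V} (h : ∀ j, coeff j φ = coeff j ψ) : φ = ψ :=
  Finsupp.ext (α := ι) (M := Fn V) h

theorem coeff_differential (j : ι) (f : Fn V) : coeff j (differential f) = partialDeriv j f := rfl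

/-- The form `∑ (∂fⁱ/∂hʲ) dhⁱ`. -/
noncomputable def partialForm (j : ι) (φ : Form V) : Form V :=
  Finsupp.mapRange (partialDeriv j) (partialDeriv_zero j) φ

theorem partialForm_add (j : ι) (φ ψ : Form V) :
    partialForm j (φ + ψ) = partialForm j φ + partialForm j ψ :=
  form_ext fun _ => partialDeriv_add j _ _

theorem partialForm_monomialForm (i j : ι) (f : Fn V) :
    partialForm j (monomialForm i f) = monomialForm i (partialDeriv j f) :=
  Finsupp.mapRange_single (hf := partialDeriv_zero j)

theorem partialForm_differential (j : ι) (f : Fn V) :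
    partialForm j (differential f) = differential (partialDeriv j f) :=
  form_ext fun i => partialDeriv_comm j i f

theorem partialDeriv_pairing (j : ι) (X : VField V) (φ : Form V) :
    partialDeriv j (pairing X φ) =
      pairing (fun i => partialDeriv j (X i)) φ + pairing X (partialForm j φ) := by
  induction φ using form_induction with
  | zero =>
    have : partialForm j (0 : Form V) = 0 := form_ext fun _ => partialDeriv_zero j
    simp [partialDeriv_zero, this]
  | add φ ψ h₁ h₂ =>
    rw [map_add, partialDeriv_add, h₁, h₂, partialForm_add, map_add, map_add]
    ring
  | single i f =>
    rw [pairing_monomialForm, partialDeriv_mul, partialForm_monomialForm, pairing_monomialForm,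
      pairing_monomialForm]
    ring

theorem coeff_lieDeriv (j : ι) (X : VField V) (φ : Form V) :
    coeff j (lieDeriv X φ) =
      act X (coeff j φ) + pairing (fun i => partialDeriv j (X i)) φ := by
  classical
  induction φ using form_induction with
  | zero =>
    rw [lieDeriv_zero, map_zero, map_zero, act, differential_zero, map_zero, add_zero]
  | add φ ψ h₁ h₂ =>
    rw [lieDeriv_add, map_add, h₁, h₂, map_add, act_add, map_add]
    ring
  | single i f =>
    rw [lieDeriv_monomialForm, map_add, map_smul, coeff_differential, pairing_monomialForm,
      smul_eq_mul]
    congr 1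
    have h : ∀ g : Fn V, coeff j (monomialForm i g) = if i = j then g else 0 := fun g =>
      Finsupp.single_apply
    rw [h, h]
    split_ifs
    · rfl
    · rw [act, differential_zero, map_zero]

theorem lieDeriv_differential (X : VField V) (f : Fn V) :
    lieDeriv X (differential f) = differential (act X f) := by
  refine form_ext fun j => ?_
  rw [coeff_lieDeriv, coeff_differential, coeff_differential, act, act, partialDeriv_pairing,
    partialForm_differential, add_comm]

/-- The commutator `[X, Y]`. -/
noncomputable def bracket (X Y : VField V) : VField V := fun i => act X (Y i) - act Y (X i)

/-- The derivation rule `(𝓛_X φ)(Y) = X(φ(Y)) - φ([X, Y])`. -/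
theorem pairing_lieDeriv (X Y : VField V) (φ : Form V) :
    pairing Y (lieDeriv X φ) = act X (pairing Y φ) - pairing (bracket X Y) φ := by
  induction φ using form_induction with
  | zero => rw [lieDeriv_zero, map_zero, map_zero, act, differential_zero, map_zero, sub_zero]
  | add φ ψ h₁ h₂ =>
    rw [lieDeriv_add, map_add, h₁, h₂, map_add, act_add, map_add]
    ring
  | single i f =>
    rw [lieDeriv_monomialForm, map_add, map_smul, pairing_monomialForm, pairing_monomialForm,
      pairing_monomialForm, act_mul, bracket, smul_eq_mul,
      show pairing Y (differential (X i)) = act Y (X i) from rfl]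
    ring

theorem act_bracket (X Y : VField V) (f : Fn V) :
    act (bracket X Y) f = act X (act Y f) - act Y (act X f) := by
  have h := pairing_lieDeriv X Y (differential f)
  rw [lieDeriv_differential] at h
  change act Y (act X f) = act X (act Y f) - act (bracket X Y) f at h
  rw [h]
  ring

theorem lieDeriv_bracket (X Y : VField V) (φ : Form V) :
    lieDeriv (bracket X Y) φ = lieDeriv X (lieDeriv Y φ) - lieDeriv Y (lieDeriv X φ) := by
  induction φ using form_induction with
  | zero => simp only [lieDeriv_zero, sub_zero]
  | add φ ψ h₁ h₂ =>
    simp only [lieDeriv_add, h₁, h₂]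
    abel
  | single i f =>
    simp only [lieDeriv_monomialForm, lieDeriv_add, lieDeriv_smul, lieDeriv_differential,
      act_bracket, map_sub]
    rw [bracket, differential_sub]
    module

/-! ### Restriction to a smaller open set -/

/-- The restriction of functions as a homomorphism of rings. -/
def restrictFnHom (hUV : U ≤ V) : Fn V →+* Fn U where
  toFun := restrictFn hUV
  map_one' := rfl
  map_mul' _ _ := rfl
  map_zero' := rfl
  map_add' _ _ := rfl

/-- The restriction of vector fields. -/
def restrictVField (hUV : U ≤ V) (Z : VField V) : VField U := fun i => restrictFnHom hUV (Z i)

theorem restrictForm_zero (hUV : U ≤ V) : restrictForm hUV (0 : Form V) = 0 := rfl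

theorem restrictForm_add (hUV : U ≤ V) (φ ψ : Form V) :
    restrictForm hUV (φ + ψ) = restrictForm hUV φ + restrictForm hUV ψ :=
  form_ext fun _ => rfl

theorem restrictForm_smul (hUV : U ≤ V) (f : Fn V) (φ : Form V) :
    restrictForm hUV (f • φ) = restrictFnHom hUV f • restrictForm hUV φ :=
  form_ext fun _ => rfl

theorem restrictForm_sub (hUV : U ≤ V) (φ ψ : Form V) :
    restrictForm hUV (φ - ψ) = restrictForm hUV φ - restrictForm hUV ψ :=
  form_ext fun _ => rfl

theorem restrictForm_sum {κ : Type*} (hUV : U ≤ V) (s : Finset κ) (φ : κ → Form V) :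
    restrictForm hUV (∑ k ∈ s, φ k) = ∑ k ∈ s, restrictForm hUV (φ k) := by
  classical
  induction s using Finset.induction_on with
  | empty => simp [restrictForm_zero]
  | insert a s ha ih => rw [Finset.sum_insert ha, Finset.sum_insert ha, restrictForm_add, ih]

theorem restrictForm_monomialForm (hUV : U ≤ V) (i : ι) (f : Fn V) :
    restrictForm hUV (monomialForm i f) = monomialForm i (restrictFnHom hUV f) :=
  Finsupp.mapRange_single (hf := rfl)

theorem restrictFnHom_partialDeriv (hUV : U ≤ V) (i : ι) (f : Fn V) :
    restrictFnHom hUV (partialDeriv i f) = partialDeriv i (restrictFnHom hUV f) := by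
  classical
  obtain ⟨s, g, hg, hfg⟩ := f.2
  refine Subtype.ext (funext fun x => ?_)
  have h1 := partialFun_eq hg hfg i ⟨x.1, hUV x.2⟩
  have h2 := partialFun_eq (f := (restrictFnHom hUV f).1) (hg.mono (Set.image_mono hUV))
    (fun x => hfg ⟨x.1, hUV x.2⟩) i x
  exact h1.trans h2.symm

theorem restrictForm_differential (hUV : U ≤ V) (f : Fn V) :
    restrictForm hUV (differential f) = differential (restrictFnHom hUV f) :=
  form_ext fun i => restrictFnHom_partialDeriv hUV i f

theorem restrictFnHom_pairing (hUV : U ≤ V) (Z : VField V) (φ : Form V) :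
    restrictFnHom hUV (pairing Z φ) = pairing (restrictVField hUV Z) (restrictForm hUV φ) := by
  induction φ using form_induction with
  | zero => rw [restrictForm_zero, map_zero, map_zero, map_zero]
  | add φ ψ h₁ h₂ => rw [map_add, map_add, h₁, h₂, restrictForm_add, map_add]
  | single i f =>
    rw [pairing_monomialForm, restrictForm_monomialForm, pairing_monomialForm, map_mul]
    rfl

theorem restrictFnHom_act (hUV : U ≤ V) (Z : VField V) (f : Fn V) :
    restrictFnHom hUV (act Z f) = act (restrictVField hUV Z) (restrictFnHom hUV f) := by
  rw [act, act, restrictFnHom_pairing, restrictForm_differential]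

theorem restrictForm_lieDeriv (hUV : U ≤ V) (Z : VField V) (φ : Form V) :
    restrictForm hUV (lieDeriv Z φ) = lieDeriv (restrictVField hUV Z) (restrictForm hUV φ) := by
  induction φ using form_induction with
  | zero => rw [lieDeriv_zero, restrictForm_zero, lieDeriv_zero]
  | add φ ψ h₁ h₂ => rw [lieDeriv_add, restrictForm_add, h₁, h₂, restrictForm_add, lieDeriv_add]
  | single i f =>
    rw [lieDeriv_monomialForm, restrictForm_add, restrictForm_monomialForm, restrictForm_smul,
      restrictForm_differential, restrictForm_monomialForm, lieDeriv_monomialForm,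
      restrictFnHom_act]
    rfl

theorem restrictForm_mem_restrict (hUV : U ≤ V) {Θ : Submodule (Fn V) (Form V)} {φ : Form V}
    (h : φ ∈ Θ) : restrictForm hUV φ ∈ restrict hUV Θ :=
  Submodule.subset_span ⟨φ, h, rfl⟩

theorem restrict_le_iff (hUV : U ≤ V) {Θ : Submodule (Fn V) (Form V)}
    {Ψ : Submodule (Fn U) (Form U)} :
    restrict hUV Θ ≤ Ψ ↔ ∀ φ ∈ Θ, restrictForm hUV φ ∈ Ψ :=
  Submodule.span_le.trans (Set.image_subset_iff (f := restrictForm hUV))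

theorem restrict_mono (hUV : U ≤ V) {Θ Θ' : Submodule (Fn V) (Form V)} (h : Θ ≤ Θ') :
    restrict hUV Θ ≤ restrict hUV Θ' :=
  Submodule.span_mono (Set.image_mono h)

theorem restrict_bot (hUV : U ≤ V) : restrict hUV (⊥ : Submodule (Fn V) (Form V)) = ⊥ := by
  rw [eq_bot_iff, restrict_le_iff]
  rintro _ rfl
  exact Submodule.zero_mem _

theorem restrictForm_mem_span (hUV : U ≤ V) {S : Set (Form V)} {φ : Form V}
    (h : φ ∈ Submodule.span (Fn V) S) :
    restrictForm hUV φ ∈ Submodule.span (Fn U) (restrictForm hUV '' S) := by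
  induction h using Submodule.span_induction with
  | mem x hx => exact Submodule.subset_span ⟨x, hx, rfl⟩
  | zero => exact Submodule.zero_mem _
  | add x y _ _ h1 h2 => rw [restrictForm_add]; exact Submodule.add_mem _ h1 h2
  | smul a x _ h => rw [restrictForm_smul]; exact Submodule.smul_mem _ _ h

theorem restrict_span (hUV : U ≤ V) (S : Set (Form V)) :
    restrict hUV (Submodule.span (Fn V) S) = Submodule.span (Fn U) (restrictForm hUV '' S) :=
  le_antisymm ((restrict_le_iff hUV).2 fun _ h => restrictForm_mem_span hUV h)
    (Submodule.span_mono (Set.image_mono Submodule.subset_span))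

theorem restrict_sup (hUV : U ≤ V) (Θ Θ' : Submodule (Fn V) (Form V)) :
    restrict hUV (Θ ⊔ Θ') = restrict hUV Θ ⊔ restrict hUV Θ' := by
  refine le_antisymm ((restrict_le_iff hUV).2 fun φ h => ?_)
    (sup_le (restrict_mono hUV le_sup_left) (restrict_mono hUV le_sup_right))
  obtain ⟨φ₁, h₁, φ₂, h₂, rfl⟩ := Submodule.mem_sup.1 h
  rw [restrictForm_add]
  exact Submodule.add_mem_sup (restrictForm_mem_restrict hUV h₁) (restrictForm_mem_restrict hUV h₂)

theorem restrict_iSup (hUV : U ≤ V) {F : ℕ → Submodule (Fn V) (Form V)} :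
    restrict hUV (⨆ l, F l) = ⨆ l, restrict hUV (F l) := by
  refine le_antisymm ((restrict_le_iff hUV).2 fun φ h => ?_)
    (iSup_le fun l => restrict_mono hUV (le_iSup F l))
  induction h using Submodule.iSup_induction' with
  | mem l φ h => exact Submodule.mem_iSup_of_mem l (restrictForm_mem_restrict hUV h)
  | zero => exact Submodule.zero_mem _
  | add φ ψ _ _ h1 h2 => rw [restrictForm_add]; exact Submodule.add_mem _ h1 h2

/-! ### Values, units and bump functions -/

/-- The value at a point. -/
def evalAt (x : V) : Fn V →+* ℝ where
  toFun f := f.1 x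
  map_one' := rfl
  map_mul' _ _ := rfl
  map_zero' := rfl
  map_add' _ _ := rfl

/-- The constant functions. -/
def constFn (V : Opens (ι → ℝ)) : ℝ →+* Fn V := algebraMap ℝ (functionRing V)

theorem evalAt_constFn (x : V) (a : ℝ) : evalAt x (constFn V a) = a := rfl

theorem fn_ext {f g : Fn V} (h : ∀ x, evalAt x f = evalAt x g) : f = g :=
  Subtype.ext (funext h)

theorem isUnit_of_ne_zero {f : Fn V} (hf : ∀ x, evalAt x f ≠ 0) : IsUnit f := by
  obtain ⟨s, g, hg, hfg⟩ := f.2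
  let f' : Fn V := ⟨fun x => (f.1 x)⁻¹, s, fun y => (g y)⁻¹, hg.inv (by
    rintro _ ⟨x, hx, rfl⟩
    rw [← hfg ⟨x, hx⟩]
    exact hf ⟨x, hx⟩), fun x => congrArg (·⁻¹) (hfg x)⟩
  exact IsUnit.of_mul_eq_one f' (fn_ext fun x => mul_inv_cancel₀ (hf x))

/-- The open set of the points where a function does not vanish. -/
def nonvanishing (f : Fn V) : Opens (ι → ℝ) where
  carrier := {x | ∃ h : x ∈ V, evalAt ⟨x, h⟩ f ≠ 0}
  is_open' := by
    obtain ⟨s, g, hg, hfg⟩ := f.2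
    have hcont : ContinuousOn (fun x : ι → ℝ => g (s.restrict x)) (V : Set (ι → ℝ)) :=
      hg.continuousOn.comp (t := s.restrict '' (V : Set (ι → ℝ)))
        (continuous_pi fun i => continuous_apply _).continuousOn (Set.mapsTo_image _ _)
    have h1 := hcont.isOpen_inter_preimage V.isOpen (isOpen_compl_singleton (x := (0 : ℝ)))
    convert h1 using 1
    ext x
    constructor
    · rintro ⟨h, h'⟩
      refine ⟨h, ?_⟩
      change g (s.restrict x) ≠ 0
      rw [← hfg ⟨x, h⟩]
      exact h'
    · rintro ⟨h, h'⟩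
      refine ⟨h, ?_⟩
      change f.1 ⟨x, h⟩ ≠ 0
      rw [hfg ⟨x, h⟩]
      exact h'

/-- A function on `V` which is `1` at `x ∈ U`, vanishes off `U`, and such that its product by any
function on `U` extends to `V`. It is supported in a cylinder around `x` over a set of finitely many
coordinates, and such a cylinder is contained in `U` by the definition of the product topology. -/
theorem exists_bump (hUV : U ≤ V) (x : U) : ∃ b : Fn V,
    evalAt x (restrictFnHom hUV b) = 1 ∧ (∀ y : V, (y : ι → ℝ) ∉ U → evalAt y b = 0) ∧
      ∀ f : Fn U, ∃ f' : Fn V, restrictFnHom hUV f' = restrictFnHom hUV b * f := by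
  classical
  obtain ⟨s, u, hu, hsub⟩ := isOpen_pi_iff.1 U.isOpen x x.2
  let O : Set (s → ℝ) := {y | ∀ i : s, y i ∈ u i}
  have hO : O ∈ nhds (s.restrict (x : ι → ℝ)) := by
    have : O = Set.pi Set.univ fun i : s => u i := by
      ext y
      simp [O]
    rw [this]
    exact set_pi_mem_nhds Set.finite_univ fun i _ => (hu i i.2).1.mem_nhds (hu i i.2).2
  obtain ⟨β, hβs, -, hβ, -, hβx⟩ := exists_contDiff_tsupport_subset (n := ⊤) hO
  have hmem : ∀ y : ι → ℝ, s.restrict y ∈ O → y ∈ U := fun y hy => hsub fun i hi => hy ⟨i, hi⟩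
  let b : Fn V := ⟨fun y => β (s.restrict (y : ι → ℝ)), s, β, hβ.contDiffOn, fun _ => rfl⟩
  refine ⟨b, hβx, fun y hy => ?_, fun f => ?_⟩
  · by_contra hne
    exact hy (hmem _ (hβs (subset_tsupport β hne)))
  · obtain ⟨t, g, hg, hfg⟩ := f.2
    let G : ((s ∪ t : Finset ι) → ℝ) → ℝ := fun z =>
      β (Finset.restrict₂ (π := fun _ => ℝ) Finset.subset_union_left z) *
        g (Finset.restrict₂ (π := fun _ => ℝ) Finset.subset_union_right z)
    have hres : ∀ {r r' : Finset ι} (h : r ⊆ r'),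
        ContDiff ℝ (⊤ : ℕ∞) (Finset.restrict₂ (π := fun _ => ℝ) h) := by
      intro r r' h
      rw [contDiff_pi]
      intro i
      exact contDiff_apply ℝ ℝ (⟨i.1, h i.2⟩ : r')
    have hG : ContDiff ℝ (⊤ : ℕ∞) G := by
      rw [contDiff_iff_contDiffAt]
      intro z
      by_cases hz : Finset.restrict₂ (π := fun _ => ℝ) Finset.subset_union_left z ∈ tsupport β
      · refine (hβ.comp (hres _)).contDiffAt.mul ?_
        refine ContDiffAt.comp z ?_ (hres _).contDiffAt
        refine hg.contDiffAt ((isOpen_restrict_image U t).mem_nhds ?_)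
        refine ⟨fun i => if h : i ∈ s ∪ t then z ⟨i, h⟩ else (x : ι → ℝ) i, hmem _ fun i => ?_, ?_⟩
        · have := hβs hz i
          simpa [Finset.restrict, Finset.restrict₂] using this
        · funext i
          simp [Finset.restrict, Finset.restrict₂]
      · refine contDiffAt_const (c := (0 : ℝ)) |>.congr_of_eventuallyEq ?_
        have h1 : (tsupport β)ᶜ ∈ nhds
            (Finset.restrict₂ (π := fun _ => ℝ) (Finset.subset_union_left (s₂ := t)) z) :=
          (isClosed_tsupport β).isOpen_compl.mem_nhds hz
        filter_upwards [(hres Finset.subset_union_left).continuous.continuousAt h1] with z' hz'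
        change β _ * _ = 0
        rw [image_eq_zero_of_notMem_tsupport hz', zero_mul]
    refine ⟨⟨fun y => G ((s ∪ t).restrict (y : ι → ℝ)), s ∪ t, G, hG.contDiffOn, fun _ => rfl⟩,
      fn_ext fun y => ?_⟩
    rw [map_mul]
    change _ = β _ * f.1 y
    rw [hfg]
    rfl

/-! ### Bases of the module of vector fields orthogonal to a diffiety -/

/-- The vector fields `Z_k` orthogonal to `Ω` and the forms `φ_j` are dual to each other, and the
forms `φ_j` generate all forms modulo `Ω`. -/
structure IsFrame (Ω : Submodule (Fn V) (Form V)) {n : ℕ} (φ : Fin n → Form V)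
    (Z : Fin n → VField V) : Prop where
  mem_orth : ∀ k, Z k ∈ orth Ω
  pairing_eq : ∀ j k, pairing (Z k) (φ j) = if j = k then 1 else 0
  sub_mem : ∀ ψ, ψ - ∑ k, pairing (Z k) ψ • φ k ∈ Ω

/-- A basis of the factor module `Φ / Ω` lifts to forms `φ_j`, and its dual basis consists of vector
fields, a vector field being an arbitrary family of values on the forms `dhⁱ`. -/
theorem exists_isFrame {Ω : Submodule (Fn V) (Form V)} (h₁ : Module.Finite (Fn V) (Form V ⧸ Ω))
    (h₂ : Module.Free (Fn V) (Form V ⧸ Ω)) :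
    ∃ (n : ℕ) (φ : Fin n → Form V) (Z : Fin n → VField V), IsFrame Ω φ Z := by
  classical
  let b₀ := Module.Free.chooseBasis (Fn V) (Form V ⧸ Ω)
  let b := b₀.reindex (Fintype.equivFin _)
  choose φ hφ using fun k => Submodule.Quotient.mk_surjective Ω (b k)
  let Z : Fin _ → VField V := fun k i => b.repr (Submodule.Quotient.mk (monomialForm i 1)) k
  have hZ : ∀ k ψ, pairing (Z k) ψ = b.repr (Submodule.Quotient.mk ψ) k := by
    intro k ψ
    induction ψ using form_induction with
    | zero => simp
    | add φ ψ h₁ h₂ =>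
      rw [map_add, h₁, h₂, Submodule.Quotient.mk_add, map_add]
      rfl
    | single i f =>
      have h1 : monomialForm i f = f • monomialForm (V := V) i 1 := by
        rw [smul_monomialForm, mul_one]
      rw [pairing_monomialForm, h1, Submodule.Quotient.mk_smul, map_smul]
      rfl
  refine ⟨_, φ, Z, fun k ω hω => ?_, fun j k => ?_, fun ψ => ?_⟩
  · rw [hZ, (Submodule.Quotient.mk_eq_zero Ω).2 hω, map_zero]
    rfl
  · rw [hZ, hφ, Module.Basis.repr_self, Finsupp.single_apply]
  · rw [← Submodule.Quotient.mk_eq_zero, Submodule.Quotient.mk_sub, sub_eq_zero]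
    conv_lhs => rw [← b.sum_repr (Submodule.Quotient.mk ψ)]
    rw [← Submodule.mkQ_apply _ (∑ k, _), map_sum]
    refine Finset.sum_congr rfl fun k _ => ?_
    rw [map_smul, Submodule.mkQ_apply, hφ, hZ]

theorem pairing_sum_left {κ : Type*} (s : Finset κ) (X : κ → VField V) (φ : Form V) :
    pairing (∑ k ∈ s, X k) φ = ∑ k ∈ s, pairing (X k) φ := by
  classical
  induction s using Finset.induction_on with
  | empty => simp [pairing_zero_left]
  | insert a s ha ih => rw [Finset.sum_insert ha, Finset.sum_insert ha, pairing_add_left, ih]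

theorem vfield_ext {X Y : VField V} (h : ∀ φ, pairing X φ = pairing Y φ) : X = Y := by
  funext i
  simpa [pairing_monomialForm] using h (monomialForm i 1)

theorem restrictVField_mem_orth (hUV : U ≤ V) {Ω : Submodule (Fn V) (Form V)} {Z : VField V}
    (hZ : Z ∈ orth Ω) : restrictVField hUV Z ∈ orth (restrict hUV Ω) := by
  have : restrict hUV Ω ≤ LinearMap.ker (pairing (restrictVField hUV Z)) := by
    rw [restrict_le_iff]
    intro φ hφ
    rw [LinearMap.mem_ker, ← restrictFnHom_pairing, hZ φ hφ, map_zero]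
  exact fun ω hω => this hω

namespace IsFrame

variable {Ω : Submodule (Fn V) (Form V)} {n : ℕ} {φ : Fin n → Form V} {Z : Fin n → VField V}

theorem eq_sum (h : IsFrame Ω φ Z) {X : VField V} (hX : X ∈ orth Ω) :
    X = ∑ k, pairing X (φ k) • Z k := by
  refine vfield_ext fun ψ => ?_
  have h1 := hX _ (h.sub_mem ψ)
  rw [map_sub, map_sum, sub_eq_zero] at h1
  rw [h1, pairing_sum_left]
  refine Finset.sum_congr rfl fun k _ => ?_
  rw [map_smul, pairing_smul_left, smul_eq_mul, mul_comm]

theorem restrict (h : IsFrame Ω φ Z) (hUV : U ≤ V) :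
    IsFrame (restrict hUV Ω) (fun k => restrictForm hUV (φ k))
      (fun k => restrictVField hUV (Z k)) where
  mem_orth k := restrictVField_mem_orth hUV (h.mem_orth k)
  pairing_eq j k := by
    rw [← restrictFnHom_pairing, h.pairing_eq]
    split_ifs
    · exact map_one _
    · exact map_zero _
  sub_mem ψ := by
    induction ψ using form_induction with
    | zero => simp
    | add ψ ψ' h₁ h₂ =>
      convert Submodule.add_mem _ h₁ h₂ using 1
      simp only [map_add, add_smul, Finset.sum_add_distrib]
      abel
    | single i f =>
      have h1 := restrictForm_mem_restrict hUV (h.sub_mem (monomialForm i 1))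
      rw [restrictForm_sub, restrictForm_sum, restrictForm_monomialForm, map_one] at h1
      convert Submodule.smul_mem _ f h1 using 1
      rw [smul_sub, smul_monomialForm, mul_one, Finset.smul_sum]
      congr 1
      refine Finset.sum_congr rfl fun k _ => ?_
      rw [restrictForm_smul, restrictFnHom_pairing, restrictForm_monomialForm, map_one, smul_smul,
        pairing_monomialForm, pairing_monomialForm, one_mul]

/-- Constant linear combinations of a frame with independent vectors of coefficients are bases. -/
theorem exists_basis (h : IsFrame Ω φ Z) {v : Fin n → Fin n → ℝ} (hv : LinearIndependent ℝ v) :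
    ∃ B : Module.Basis (Fin n) (Fn V) (orth Ω),
      ∀ j, (B j : VField V) = ∑ k, constFn V (v j k) • Z k := by
  classical
  let A : Matrix (Fin n) (Fin n) ℝ := Matrix.of v
  have hA : IsUnit A := Matrix.linearIndependent_rows_iff_isUnit.1 hv
  have hdet : IsUnit A.det := (Matrix.isUnit_iff_isUnit_det A).1 hA
  let A₁ : Matrix (Fin n) (Fin n) (Fn V) := A.map (constFn V)
  let A₂ : Matrix (Fin n) (Fin n) (Fn V) := A⁻¹.map (constFn V)
  have h12 : A₁ * A₂ = 1 := by
    rw [← Matrix.map_mul, Matrix.mul_nonsing_inv A hdet, Matrix.map_one _ (map_zero _) (map_one _)]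
  have h21 : A₂ * A₁ = 1 := by
    rw [← Matrix.map_mul, Matrix.nonsing_inv_mul A hdet, Matrix.map_one _ (map_zero _) (map_one _)]
  have hsum : ∀ c : Fin n → Fn V, ∑ j, c j • ∑ k, constFn V (v j k) • Z k =
      ∑ k, (Matrix.vecMul c A₁) k • Z k := by
    intro c
    simp only [Finset.smul_sum, smul_smul]
    rw [Finset.sum_comm]
    refine Finset.sum_congr rfl fun k _ => ?_
    rw [Matrix.vecMul_eq_sum, Finset.sum_apply, Finset.sum_smul]
    rfl
  let w : Fin n → orth Ω := fun j => ⟨∑ k, constFn V (v j k) • Z k,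
    Submodule.sum_mem _ fun k _ => Submodule.smul_mem _ _ (h.mem_orth k)⟩
  have hw : ∀ c : Fin n → Fn V, ((∑ j, c j • w j : orth Ω) : VField V) =
      ∑ k, (Matrix.vecMul c A₁) k • Z k := by
    intro c
    rw [← hsum, Submodule.coe_sum]
    rfl
  have hli : LinearIndependent (Fn V) w := by
    rw [Fintype.linearIndependent_iff]
    intro c hc
    have h1 := hw c
    rw [hc] at h1
    have h2 : Matrix.vecMul c A₁ = 0 := by
      funext j
      have h3 := congrArg (fun X => pairing X (φ j)) h1
      simp only [Submodule.coe_zero, pairing_zero_left, pairing_sum_left, pairing_smul_left,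
        h.pairing_eq, mul_ite, mul_one, mul_zero, Finset.sum_ite_eq, Finset.mem_univ,
        if_true] at h3
      exact h3.symm
    have h4 : c = Matrix.vecMul (Matrix.vecMul c A₁) A₂ := by
      rw [Matrix.vecMul_vecMul, h12, Matrix.vecMul_one]
    rw [h2, Matrix.zero_vecMul] at h4
    exact congrFun h4
  have hsp : ⊤ ≤ Submodule.span (Fn V) (Set.range w) := by
    rintro ⟨X, hX⟩ -
    let p : Fin n → Fn V := fun k => pairing X (φ k)
    have h1 : (⟨X, hX⟩ : orth Ω) = ∑ j, (Matrix.vecMul p A₂) j • w j := by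
      refine Subtype.ext ?_
      rw [hw, Matrix.vecMul_vecMul, h21, Matrix.vecMul_one]
      exact h.eq_sum hX
    rw [h1]
    exact Submodule.sum_mem _ fun j _ => Submodule.smul_mem _ _ (Submodule.subset_span ⟨j, rfl⟩)
  exact ⟨Module.Basis.mk hli hsp, fun j => by rw [Module.Basis.mk_apply]⟩

end IsFrame

/-! ### The multiplications on the graded module -/

section Mult

variable {Ω : Submodule (Fn V) (Form V)} {F : ℕ → Submodule (Fn V) (Form V)}

/-- The class in `𝓜_l` of a form in `Ω_l`. -/
noncomputable def grMk (F : ℕ → Submodule (Fn V) (Form V)) (l : ℕ) : F l →ₗ[Fn V] Gr F l :=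
  ((prevTerm F l).submoduleOf (F l)).mkQ

theorem grMk_surjective (F : ℕ → Submodule (Fn V) (Form V)) (l : ℕ) :
    Function.Surjective (grMk F l) := Submodule.mkQ_surjective _

theorem grMk_eq_zero {l : ℕ} {ω : F l} : grMk F l ω = 0 ↔ (ω : Form V) ∈ prevTerm F l :=
  Submodule.Quotient.mk_eq_zero _

theorem mult_grMk (h : IsGoodFiltration Ω F) (Z : orth Ω) (l : ℕ) (ω : F l) :
    mult h Z l (grMk F l ω) = grMk F (l + 1) ⟨lieDeriv Z.1 ω.1, h.lieDeriv_mem Z.2 ω.2⟩ := rfl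

theorem IsGoodFiltration.le (h : IsGoodFiltration Ω F) (l : ℕ) : F l ≤ Ω :=
  h.iSup_eq ▸ le_iSup F l

theorem IsGoodFiltration.lieDeriv_mem_self (h : IsGoodFiltration Ω F) {Z : VField V}
    (hZ : Z ∈ orth Ω) {ω : Form V} (hω : ω ∈ Ω) : lieDeriv Z ω ∈ Ω := by
  rw [← h.iSup_eq] at hω
  induction hω using Submodule.iSup_induction' with
  | mem l ω hω => exact h.le _ (h.lieDeriv_mem hZ hω)
  | zero => rw [lieDeriv_zero]; exact Submodule.zero_mem _
  | add φ ψ _ _ h1 h2 => rw [lieDeriv_add]; exact Submodule.add_mem _ h1 h2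

/-- The module `𝓗` is closed under commutators. -/
theorem IsGoodFiltration.bracket_mem (h : IsGoodFiltration Ω F) {X Y : VField V}
    (hX : X ∈ orth Ω) (hY : Y ∈ orth Ω) : bracket X Y ∈ orth Ω := by
  intro ω hω
  have h1 := pairing_lieDeriv X Y ω
  rw [hY ω hω, hY _ (h.lieDeriv_mem_self hX hω), act, differential_zero, map_zero, zero_sub] at h1
  exact neg_eq_zero.1 h1.symm

theorem mult_comm (h : IsGoodFiltration Ω F) (X Y : orth Ω) (l : ℕ) (x : Gr F l) :
    mult h X (l + 1) (mult h Y l x) = mult h Y (l + 1) (mult h X l x) := by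
  obtain ⟨ω, rfl⟩ := grMk_surjective F l x
  rw [mult_grMk, mult_grMk, mult_grMk, mult_grMk, ← sub_eq_zero, ← map_sub, grMk_eq_zero]
  change lieDeriv X.1 (lieDeriv Y.1 ω.1) - lieDeriv Y.1 (lieDeriv X.1 ω.1) ∈ F (l + 1)
  rw [← lieDeriv_bracket]
  exact h.lieDeriv_mem (h.bracket_mem X.2 Y.2) ω.2

theorem lieDeriv_sum_smul_left {κ : Type*} (s : Finset κ) (f : κ → Fn V) {X : κ → VField V}
    (hX : ∀ k, X k ∈ orth Ω) {ω : Form V} (hω : ω ∈ Ω) :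
    lieDeriv (∑ k ∈ s, f k • X k) ω = ∑ k ∈ s, f k • lieDeriv (X k) ω := by
  classical
  induction s using Finset.induction_on with
  | empty =>
    have := lieDeriv_smul_left 0 (0 : VField V) ω
    rw [zero_smul, zero_smul, pairing_zero_left, zero_smul, add_zero] at this
    simpa using this
  | insert a s ha ih =>
    rw [Finset.sum_insert ha, Finset.sum_insert ha, lieDeriv_add_left, ih, lieDeriv_smul_left,
      hX a ω hω, zero_smul, add_zero]

theorem mult_sum_smul (h : IsGoodFiltration Ω F) {n : ℕ} (f : Fin n → Fn V) (X : Fin n → orth Ω)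
    (Y : orth Ω) (hY : (Y : VField V) = ∑ k, f k • (X k : VField V)) (l : ℕ) :
    mult h Y l = ∑ k, f k • mult h (X k) l := by
  refine LinearMap.ext fun x => ?_
  obtain ⟨ω, rfl⟩ := grMk_surjective F l x
  rw [LinearMap.sum_apply]
  simp only [LinearMap.smul_apply, mult_grMk]
  simp only [← map_smul, ← map_sum]
  congr 1
  refine Subtype.ext ?_
  change lieDeriv Y.1 ω.1 = _
  rw [hY, lieDeriv_sum_smul_left _ f (fun k => (X k).2) (h.le l ω.2), Submodule.coe_sum]
  rfl

theorem iSup_range_mult_eq_top (h : IsGoodFiltration Ω F) {n : ℕ} {X : Fin n → orth Ω}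
    (hX : ⊤ ≤ Submodule.span (Fn V) (Set.range X)) {l : ℕ}
    (hl : F l ⊔ lieSpan (orth Ω) (F l) = F (l + 1)) :
    ⨆ k, LinearMap.range (mult h (X k) l) = ⊤ := by
  set S := ⨆ k, LinearMap.range (mult h (X k) l) with hS
  have h1 : F (l + 1) ≤ (S.comap (grMk F (l + 1))).map (F (l + 1)).subtype := by
    nth_rewrite 1 [← hl]
    refine sup_le (fun ω hω => ?_) (Submodule.span_le.2 ?_)
    · refine ⟨⟨ω, h.mono l hω⟩, ?_, rfl⟩
      have h2 : grMk F (l + 1) ⟨ω, h.mono l hω⟩ = 0 := grMk_eq_zero.2 hω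
      change grMk F (l + 1) ⟨ω, h.mono l hω⟩ ∈ S
      rw [h2]
      exact Submodule.zero_mem _
    · rintro _ ⟨Z, hZ, ω, hω, rfl⟩
      refine ⟨⟨lieDeriv Z ω, h.lieDeriv_mem hZ hω⟩, ?_, rfl⟩
      obtain ⟨f, hf⟩ := (Submodule.mem_span_range_iff_exists_fun _).1
        (hX (Submodule.mem_top (x := (⟨Z, hZ⟩ : orth Ω))))
      have h2 := mult_sum_smul h f X ⟨Z, hZ⟩ (by
        rw [← hf, Submodule.coe_sum]
        rfl) l
      change mult h ⟨Z, hZ⟩ l (grMk F l ⟨ω, hω⟩) ∈ S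
      rw [h2, LinearMap.sum_apply]
      exact Submodule.sum_mem _ fun k _ => Submodule.smul_mem _ _
        (Submodule.mem_iSup_of_mem k (LinearMap.mem_range_self _ _))
  refine top_le_iff.1 fun x _ => ?_
  obtain ⟨ω, rfl⟩ := grMk_surjective F (l + 1) x
  obtain ⟨ω', hω', he⟩ := h1 ω.2
  rw [← Subtype.ext he]
  exact hω'

/-- The class of `ω` belongs to the sum of the images of the first `i` multiplications. -/
theorem grMk_mem_imageSum_iff (h : IsGoodFiltration Ω F) (X : ℕ → orth Ω) (i l : ℕ)
    (ω : F (l + 1)) :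
    grMk F (l + 1) ω ∈ imageSum (fun j => mult h (X j)) i l ↔
      ∃ ξ : ℕ → Form V, (∀ j, ξ j ∈ F l) ∧
        (ω : Form V) - ∑ j ∈ Finset.range i, lieDeriv (X j : VField V) (ξ j) ∈ F l := by
  induction i generalizing ω with
  | zero =>
    rw [imageSum_zero, Submodule.mem_bot, grMk_eq_zero]
    simp only [Finset.range_zero, Finset.sum_empty, sub_zero]
    exact ⟨fun h => ⟨0, fun _ => Submodule.zero_mem _, h⟩, fun h => h.choose_spec.2⟩
  | succ i ih =>
    rw [imageSum_succ, Submodule.mem_sup]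
    constructor
    · rintro ⟨y, hy, _, ⟨z, rfl⟩, hyz⟩
      obtain ⟨ζ, rfl⟩ := grMk_surjective F l z
      have h1 : y = grMk F (l + 1) (ω - ⟨lieDeriv (X i).1 ζ.1, h.lieDeriv_mem (X i).2 ζ.2⟩) := by
        rw [map_sub, ← hyz]
        exact (add_sub_cancel_right _ _).symm
      rw [h1, ih] at hy
      obtain ⟨ξ, hξ, hξ'⟩ := hy
      refine ⟨Function.update ξ i ζ, fun j => ?_, ?_⟩
      · by_cases hj : j = i
        · subst hj
          rw [Function.update_self]
          exact ζ.2
        · rw [Function.update_of_ne hj]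
          exact hξ j
      · rw [Finset.sum_range_succ, Function.update_self, Finset.sum_congr rfl fun j hj => by
          rw [Function.update_of_ne (Finset.mem_range.1 hj).ne]]
        convert hξ' using 1
        rw [Submodule.coe_sub, sub_add_eq_sub_sub, sub_right_comm]
    · rintro ⟨ξ, hξ, hξ'⟩
      refine ⟨grMk F (l + 1) (ω - ⟨lieDeriv (X i).1 (ξ i), h.lieDeriv_mem (X i).2 (hξ i)⟩),
        (ih _).2 ⟨ξ, hξ, ?_⟩, mult h (X i) l (grMk F l ⟨ξ i, hξ i⟩),
        LinearMap.mem_range_self _ _, ?_⟩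
      · rw [Finset.sum_range_succ] at hξ'
        convert hξ' using 1
        rw [Submodule.coe_sub, sub_add_eq_sub_sub, sub_right_comm]
      · rw [mult_grMk, ← map_add, sub_add_cancel]

/-- The component `𝓐(i)𝓜 ∩ 𝓜_{l+1}` is already `∑_{j < i} Z_j 𝓜_l`, the multiplications being
commutative. -/
theorem idealPart_succ (h : IsGoodFiltration Ω F) {n : ℕ} (X : ℕ → orth Ω) {i : ℕ} (hi : i ≤ n)
    (l : ℕ) : idealPart h (fun j : Fin n => X j) i (l + 1) =
      imageSum (fun j => mult h (X j)) i l := by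
  have h1 : (⨆ j : Fin n, ⨆ _ : (j : ℕ) < i, LinearMap.range (mult h (X j) l)) =
      imageSum (fun j => mult h (X j)) i l := by
    refine le_antisymm (iSup_le fun j => iSup_le fun hj => ?_)
      (imageSum_le_iff.2 fun j hj x => ?_)
    · rintro _ ⟨x, rfl⟩
      exact apply_mem_imageSum (T := fun j => mult h (X j)) hj x
    · exact Submodule.mem_iSup_of_mem ⟨j, hj.trans_le hi⟩
        (Submodule.mem_iSup_of_mem hj (LinearMap.mem_range_self _ x))
  rw [idealPart, h1, sup_eq_left, iSup_le_iff]
  intro Y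
  cases l with
  | zero => rw [idealPart, Submodule.map_bot]; exact bot_le
  | succ l =>
    rw [idealPart_succ h X hi l, Submodule.map_le_iff_le_comap, imageSum_le_iff]
    intro j hj x
    rw [Submodule.mem_comap, mult_comm]
    exact apply_mem_imageSum (T := fun j => mult h (X j)) hj _

end Mult

/-! ### Restriction of good filtrations -/

/-- A basis of `B / A` lifts to a family which generates `B` modulo `A` and is independent modulo `A`. -/
theorem exists_lifts_of_basis {R E κ : Type*} [CommRing R] [AddCommGroup E] [Module R E] [Fintype κ]
    {A B : Submodule R E} (hAB : A ≤ B) (b : Module.Basis κ R (B ⧸ A.submoduleOf B)) :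
    ∃ φ : κ → E, B = A ⊔ Submodule.span R (Set.range φ) ∧
      ∀ c : κ → R, ∑ k, c k • φ k ∈ A → c = 0 := by
  choose φ hφ using fun k => Submodule.Quotient.mk_surjective (A.submoduleOf B) (b k)
  have hmk : ∀ c : κ → R, Submodule.Quotient.mk (p := A.submoduleOf B) (∑ k, c k • φ k) =
      ∑ k, c k • b k := by
    intro c
    rw [← Submodule.mkQ_apply, map_sum]
    exact Finset.sum_congr rfl fun k _ => by rw [map_smul, Submodule.mkQ_apply, hφ]
  have hcoe : ∀ c : κ → R, ((∑ k, c k • φ k : B) : E) = ∑ k, c k • (φ k : E) := fun c => by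
    rw [Submodule.coe_sum]
    rfl
  refine ⟨fun k => φ k, le_antisymm (fun x hx => ?_) (sup_le hAB (Submodule.span_le.2 ?_)),
    fun c hc => ?_⟩
  · have h1 : Submodule.Quotient.mk (p := A.submoduleOf B) (⟨x, hx⟩ -
        ∑ k, b.repr (Submodule.Quotient.mk ⟨x, hx⟩) k • φ k) = 0 := by
      rw [Submodule.Quotient.mk_sub, hmk, b.sum_repr, sub_self]
    rw [Submodule.Quotient.mk_eq_zero] at h1
    have h2 : x - ∑ k, b.repr (Submodule.Quotient.mk ⟨x, hx⟩) k • (φ k : E) ∈ A := by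
      rw [← hcoe]
      exact h1
    rw [← sub_add_cancel x (∑ k, b.repr (Submodule.Quotient.mk ⟨x, hx⟩) k • (φ k : E))]
    exact Submodule.add_mem_sup h2 (Submodule.sum_mem _ fun k _ =>
      Submodule.smul_mem _ _ (Submodule.subset_span ⟨k, rfl⟩))
  · rintro _ ⟨k, rfl⟩
    exact (φ k).2
  · have h1 : Submodule.Quotient.mk (p := A.submoduleOf B) (∑ k, c k • φ k) = 0 := by
      rw [Submodule.Quotient.mk_eq_zero]
      change ((∑ k, c k • φ k : B) : E) ∈ A
      rwa [hcoe]
    rw [hmk] at h1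
    exact funext (Fintype.linearIndependent_iff.1 b.linearIndependent c h1)

theorem nonempty_basis_of_lifts {R E κ : Type*} [CommRing R] [AddCommGroup E] [Module R E]
    [Fintype κ] {A B : Submodule R E} {φ : κ → E}
    (hB : B = A ⊔ Submodule.span R (Set.range φ))
    (hφ : ∀ c : κ → R, ∑ k, c k • φ k ∈ A → c = 0) :
    Nonempty (Module.Basis κ R (B ⧸ A.submoduleOf B)) := by
  have hmem : ∀ k, φ k ∈ B := fun k => by
    rw [hB]
    exact Submodule.mem_sup_right (Submodule.subset_span ⟨k, rfl⟩)
  let w : κ → B ⧸ A.submoduleOf B := fun k => Submodule.Quotient.mk ⟨φ k, hmem k⟩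
  have hw : ∀ c : κ → R, ∑ k, c k • w k = Submodule.Quotient.mk (p := A.submoduleOf B)
      (∑ k, c k • (⟨φ k, hmem k⟩ : B)) := by
    intro c
    rw [← Submodule.mkQ_apply, map_sum]
    rfl
  have hcoe : ∀ c : κ → R, ((∑ k, c k • (⟨φ k, hmem k⟩ : B) : B) : E) = ∑ k, c k • φ k :=
    fun c => by
      rw [Submodule.coe_sum]
      rfl
  have hli : LinearIndependent R w := by
    rw [Fintype.linearIndependent_iff]
    intro c hc
    rw [hw, Submodule.Quotient.mk_eq_zero] at hc
    change ((∑ k, c k • (⟨φ k, hmem k⟩ : B) : B) : E) ∈ A at hc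
    rw [hcoe] at hc
    exact congrFun (hφ c hc)
  have hsp : ⊤ ≤ Submodule.span R (Set.range w) := by
    intro x _
    obtain ⟨⟨y, hy⟩, rfl⟩ := Submodule.Quotient.mk_surjective _ x
    have hy' := hy
    rw [hB] at hy'
    obtain ⟨a, ha, z, hz, rfl⟩ := Submodule.mem_sup.1 hy'
    obtain ⟨c, rfl⟩ := (Submodule.mem_span_range_iff_exists_fun R).1 hz
    have h1 : Submodule.Quotient.mk (p := A.submoduleOf B) ⟨a + ∑ k, c k • φ k, hy⟩ =
        ∑ k, c k • w k := by
      rw [hw, Submodule.Quotient.eq]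
      change a + ∑ k, c k • φ k - ((∑ k, c k • (⟨φ k, hmem k⟩ : B) : B) : E) ∈ A
      rwa [hcoe, add_sub_cancel_right]
    rw [h1]
    exact Submodule.sum_mem _ fun k _ => Submodule.smul_mem _ _ (Submodule.subset_span ⟨k, rfl⟩)
  exact ⟨Module.Basis.mk hli hsp⟩

/-- Forms which are independent modulo a submodule remain so after restriction: a relation on `U`
extends to `V` after multiplication by a bump function. -/
theorem eq_zero_of_sum_restrictForm_mem (hUV : U ≤ V) {κ : Type*} [Fintype κ]
    {A : Submodule (Fn V) (Form V)} {φ : κ → Form V}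
    (hφ : ∀ c : κ → Fn V, ∑ k, c k • φ k ∈ A → c = 0) {c : κ → Fn U}
    (hc : ∑ k, c k • restrictForm hUV (φ k) ∈ restrict hUV A) : c = 0 := by
  funext k
  refine fn_ext fun x => ?_
  obtain ⟨b, hbx, hb0, hb⟩ := exists_bump hUV x
  have hA : ∀ θ ∈ restrict hUV A, ∀ a : Fn U, ∃ θ' ∈ A,
      restrictForm hUV θ' = (restrictFnHom hUV b * a) • θ := by
    intro θ hθ
    induction hθ using Submodule.span_induction with
    | mem θ h =>
      obtain ⟨ω, hω, rfl⟩ := h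
      intro a
      obtain ⟨a', ha'⟩ := hb a
      exact ⟨a' • ω, A.smul_mem _ hω, by rw [restrictForm_smul, ha']⟩
    | zero => exact fun a => ⟨0, A.zero_mem, by rw [restrictForm_zero, smul_zero]⟩
    | add θ₁ θ₂ _ _ h₁ h₂ =>
      intro a
      obtain ⟨θ₁', h₁, h₁'⟩ := h₁ a
      obtain ⟨θ₂', h₂, h₂'⟩ := h₂ a
      exact ⟨θ₁' + θ₂', A.add_mem h₁ h₂, by rw [restrictForm_add, h₁', h₂', smul_add]⟩
    | smul r θ _ h =>
      intro a
      obtain ⟨θ', h, h'⟩ := h (a * r)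
      exact ⟨θ', h, by rw [h', smul_smul, mul_assoc]⟩
  obtain ⟨θ, hθ, hθ'⟩ := hA _ hc 1
  choose c' hc' using fun k => hb (c k)
  have h0 : restrictForm hUV (∑ k, c' k • φ k - θ) = 0 := by
    rw [restrictForm_sub, restrictForm_sum, hθ', mul_one, Finset.smul_sum, sub_eq_zero]
    exact Finset.sum_congr rfl fun k _ => by rw [restrictForm_smul, hc', mul_smul]
  have h1 : b • (∑ k, c' k • φ k - θ) = 0 := by
    refine form_ext fun j => fn_ext fun y => ?_
    rw [map_smul, smul_eq_mul, map_mul, map_zero, map_zero]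
    by_cases hy : (y : ι → ℝ) ∈ U
    · have h2 : coeff j (restrictForm hUV (∑ k, c' k • φ k - θ)) = 0 := by rw [h0, map_zero]
      have h3 : evalAt ⟨y, hy⟩ (coeff j (restrictForm hUV (∑ k, c' k • φ k - θ))) = 0 := by
        rw [h2, map_zero]
      exact mul_eq_zero_of_right _ h3
    · rw [hb0 y hy, zero_mul]
  have h2 : (fun k => b * c' k) = 0 := by
    refine hφ _ ?_
    rw [smul_sub, sub_eq_zero, Finset.smul_sum] at h1
    simp only [mul_smul]
    rw [h1]
    exact A.smul_mem _ hθ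
  have h3 : evalAt x (restrictFnHom hUV (b * c' k)) = 0 := by
    rw [show b * c' k = 0 from congrFun h2 k, map_zero, map_zero]
  rw [map_mul, map_mul, hc', map_mul, hbx, one_mul, one_mul] at h3
  rw [h3]
  rfl

/-- Restriction keeps a factor module `B / A` free with the same index set of a basis. -/
theorem nonempty_basis_restrict (hUV : U ≤ V) {κ : Type*} [Fintype κ]
    {A B : Submodule (Fn V) (Form V)} (hAB : A ≤ B)
    (b : Module.Basis κ (Fn V) (B ⧸ A.submoduleOf B)) :
    Nonempty (Module.Basis κ (Fn U)
      (restrict hUV B ⧸ (restrict hUV A).submoduleOf (restrict hUV B))) := by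
  obtain ⟨φ, hB, hφ⟩ := exists_lifts_of_basis hAB b
  refine nonempty_basis_of_lifts (φ := fun k => restrictForm hUV (φ k)) ?_
    fun c hc => eq_zero_of_sum_restrictForm_mem hUV hφ hc
  rw [hB, restrict_sup, restrict_span, ← Set.range_comp]
  rfl

theorem free_restrict (hUV : U ≤ V) {B : Submodule (Fn V) (Form V)} [Module.Finite (Fn V) B]
    [Module.Free (Fn V) B] : Module.Free (Fn U) (restrict hUV B) := by
  have h1 : (⊥ : Submodule (Fn V) (Form V)).submoduleOf B = ⊥ := by
    rw [Submodule.submoduleOf, Submodule.comap_bot, Submodule.ker_subtype]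
  have h2 : (⊥ : Submodule (Fn U) (Form U)).submoduleOf (restrict hUV B) = ⊥ := by
    rw [Submodule.submoduleOf, Submodule.comap_bot, Submodule.ker_subtype]
  obtain ⟨b⟩ := nonempty_basis_restrict hUV (bot_le (a := B))
    ((Module.Free.chooseBasis (Fn V) B).map (Submodule.quotEquivOfEqBot _ h1).symm)
  rw [restrict_bot] at b
  exact Module.Free.of_basis (b.map (Submodule.quotEquivOfEqBot _ h2))

theorem finite_restrict (hUV : U ≤ V) {B : Submodule (Fn V) (Form V)} [Module.Finite (Fn V) B] :
    Module.Finite (Fn U) (restrict hUV B) := by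
  classical
  obtain ⟨s, hs⟩ := Module.Finite.iff_fg.1 (‹_› : Module.Finite (Fn V) B)
  refine Module.Finite.iff_fg.2 ⟨s.image (restrictForm hUV), ?_⟩
  rw [Finset.coe_image, ← restrict_span, hs]

section Filtration

variable {Ω : Submodule (Fn V) (Form V)} {F : ℕ → Submodule (Fn V) (Form V)}

theorem restrict_lieSpan_le (hUV : U ≤ V) (Θ : Submodule (Fn V) (Form V)) :
    restrict hUV (lieSpan (orth Ω) Θ) ≤ lieSpan (orth (restrict hUV Ω)) (restrict hUV Θ) := by
  rw [lieSpan, restrict_span, Submodule.span_le]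
  rintro _ ⟨_, ⟨Z, hZ, ω, hω, rfl⟩, rfl⟩
  exact Submodule.subset_span ⟨_, restrictVField_mem_orth hUV hZ, _,
    restrictForm_mem_restrict hUV hω, restrictForm_lieDeriv hUV Z ω⟩

theorem lieSpan_restrict_le (hUV : U ≤ V) {n : ℕ} {φ : Fin n → Form V} {Z : Fin n → VField V}
    (hZ : IsFrame Ω φ Z) {Θ Ψ : Submodule (Fn V) (Form V)} (hΘ : Θ ≤ Ω) (hΘΨ : Θ ≤ Ψ)
    (hΨ : lieSpan (orth Ω) Θ ≤ Ψ) :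
    lieSpan (orth (restrict hUV Ω)) (restrict hUV Θ) ≤ restrict hUV Ψ := by
  refine Submodule.span_le.2 ?_
  rintro _ ⟨X, hX, θ, hθ, rfl⟩
  change lieDeriv X θ ∈ restrict hUV Ψ
  induction hθ using Submodule.span_induction with
  | mem θ h =>
    obtain ⟨ω, hω, rfl⟩ := h
    rw [(hZ.restrict hUV).eq_sum hX, lieDeriv_sum_smul_left (Ω := restrict hUV Ω) _ _
      (fun k => (hZ.restrict hUV).mem_orth k) (restrictForm_mem_restrict hUV (hΘ hω))]
    refine Submodule.sum_mem _ fun k _ => Submodule.smul_mem _ _ ?_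
    rw [← restrictForm_lieDeriv]
    exact restrictForm_mem_restrict hUV
      (hΨ (Submodule.subset_span ⟨Z k, hZ.mem_orth k, ω, hω, rfl⟩))
  | zero => rw [lieDeriv_zero]; exact Submodule.zero_mem _
  | add θ₁ θ₂ _ _ h₁ h₂ => rw [lieDeriv_add]; exact Submodule.add_mem _ h₁ h₂
  | smul a θ hθ h =>
    rw [lieDeriv_smul]
    exact Submodule.add_mem _ (Submodule.smul_mem _ _ h)
      (Submodule.smul_mem _ _ (restrict_mono hUV hΘΨ hθ))

theorem IsGoodFiltration.restrict (hF : IsGoodFiltration Ω F) (hUV : U ≤ V) {n : ℕ}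
    {φ : Fin n → Form V} {Z : Fin n → VField V} (hZ : IsFrame Ω φ Z) :
    IsGoodFiltration (restrict hUV Ω) (fun l => restrict hUV (F l)) where
  mono l := restrict_mono hUV (hF.mono l)
  iSup_eq := by rw [← restrict_iSup, hF.iSup_eq]
  finite l := by
    have := hF.finite l
    exact finite_restrict hUV
  free l := by
    have := hF.finite l
    have := hF.free l
    exact free_restrict hUV
  lie_le l := lieSpan_restrict_le hUV hZ (hF.le l) (hF.mono l) (hF.lie_le l)
  eventually_eq := by
    obtain ⟨L, hL⟩ := hF.eventually_eq
    refine ⟨L, fun l hl => le_antisymm (sup_le (restrict_mono hUV (hF.mono l))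
      (lieSpan_restrict_le hUV hZ (hF.le l) (hF.mono l) (hF.lie_le l))) ?_⟩
    rw [← hL l hl, restrict_sup]
    exact sup_le_sup_left (restrict_lieSpan_le hUV _) _

theorem IsGoodFiltration.lift (hF : IsGoodFiltration Ω F) (c : ℕ) :
    IsGoodFiltration Ω (lift F c) where
  mono l := by
    have h := hF.mono (l + c)
    rwa [Nat.add_right_comm] at h
  iSup_eq := by
    rw [← hF.iSup_eq]
    exact (monotone_nat_of_le_succ hF.mono).iSup_nat_add c
  finite l := hF.finite (l + c)
  free l := hF.free (l + c)
  lie_le l := by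
    have h := hF.lie_le (l + c)
    rwa [Nat.add_right_comm] at h
  eventually_eq := by
    obtain ⟨L, hL⟩ := hF.eventually_eq
    refine ⟨L, fun l hl => ?_⟩
    have h := hL (l + c) (by omega)
    rwa [Nat.add_right_comm] at h

theorem prevTerm_le (hF : IsGoodFiltration Ω F) (l : ℕ) : prevTerm F l ≤ F l := by
  cases l with
  | zero => exact bot_le
  | succ l => exact hF.mono l

theorem prevTerm_restrict (hUV : U ≤ V) (F : ℕ → Submodule (Fn V) (Form V)) (l : ℕ) :
    prevTerm (fun l => restrict hUV (F l)) l = restrict hUV (prevTerm F l) := by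
  cases l with
  | zero => exact (restrict_bot hUV).symm
  | succ l => rfl

instance (F : ℕ → Submodule (Fn V) (Form V)) (l : ℕ) [Module.Finite (Fn V) (F l)] :
    Module.Finite (Fn V) (Gr F l) :=
  inferInstanceAs (Module.Finite (Fn V) (F l ⧸ (prevTerm F l).submoduleOf (F l)))

theorem finrank_gr_restrict [Nontrivial (Fn U)] (hF : IsGoodFiltration Ω F) (hUV : U ≤ V) (l : ℕ)
    [Module.Free (Fn V) (Gr F l)] :
    Module.finrank (Fn U) (Gr (fun l => restrict hUV (F l)) l) =
      Module.finrank (Fn V) (Gr F l) := by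
  have : Nontrivial (Fn V) := (restrictFnHom hUV).domain_nontrivial
  have := hF.finite l
  let b := Module.Free.chooseBasis (Fn V) (Gr F l)
  obtain ⟨b'⟩ := nonempty_basis_restrict hUV (prevTerm_le hF l) b
  rw [← prevTerm_restrict hUV F l] at b'
  rw [Module.finrank_eq_card_basis b, Module.finrank_eq_card_basis b']

/-- The restriction `Ω_l / Ω_{l-1} → Ω_l|_U / Ω_{l-1}|_U`. -/
noncomputable def restrictGr (hUV : U ≤ V) (F : ℕ → Submodule (Fn V) (Form V)) (l : ℕ) :
    Gr F l →ₛₗ[restrictFnHom hUV] Gr (fun l => restrict hUV (F l)) l :=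
  Submodule.mapQ _ _
    { toFun := fun ω : F l => (⟨restrictForm hUV ω, restrictForm_mem_restrict hUV ω.2⟩ :
        restrict hUV (F l))
      map_add' := fun _ _ => Subtype.ext (restrictForm_add hUV _ _)
      map_smul' := fun _ _ => Subtype.ext (restrictForm_smul hUV _ _) }
    (by
      intro ω hω
      change restrictForm hUV ω ∈ prevTerm _ l
      rw [prevTerm_restrict]
      exact restrictForm_mem_restrict hUV hω)

theorem restrictGr_grMk (hUV : U ≤ V) (l : ℕ) (ω : F l) :
    restrictGr hUV F l (grMk F l ω) =
      grMk (fun l => restrict hUV (F l)) l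
        ⟨restrictForm hUV ω, restrictForm_mem_restrict hUV ω.2⟩ := rfl

theorem span_range_restrictGr (hUV : U ≤ V) (F : ℕ → Submodule (Fn V) (Form V)) (l : ℕ) :
    ⊤ ≤ Submodule.span (Fn U) (Set.range (restrictGr hUV F l)) := by
  have h1 : restrict hUV (F l) ≤ ((Submodule.span (Fn U) (Set.range (restrictGr hUV F l))).comap
      (grMk (fun l => restrict hUV (F l)) l)).map (restrict hUV (F l)).subtype := by
    rw [restrict_le_iff]
    intro ω hω
    exact ⟨⟨_, restrictForm_mem_restrict hUV hω⟩,
      Submodule.subset_span ⟨grMk F l ⟨ω, hω⟩, rfl⟩, rfl⟩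
  intro x _
  obtain ⟨ω, rfl⟩ := grMk_surjective _ l x
  obtain ⟨ω', hω', he⟩ := h1 ω.2
  rw [← Subtype.ext he]
  exact hω'

theorem restrictGr_mult (hF : IsGoodFiltration Ω F) (hUV : U ≤ V)
    (hG : IsGoodFiltration (Diffiety.restrict hUV Ω) (fun l => Diffiety.restrict hUV (F l)))
    (X : orth Ω) (Y : orth (Diffiety.restrict hUV Ω))
    (hXY : (Y : VField U) = restrictVField hUV X) (l : ℕ) (x : Gr F l) :
    restrictGr hUV F (l + 1) (mult hF X l x) = mult hG Y l (restrictGr hUV F l x) := by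
  obtain ⟨ω, rfl⟩ := grMk_surjective F l x
  rw [mult_grMk, restrictGr_grMk, restrictGr_grMk, mult_grMk]
  congr 1
  refine Subtype.ext ?_
  change restrictForm hUV (lieDeriv X.1 ω.1) = lieDeriv Y.1 (restrictForm hUV ω.1)
  rw [restrictForm_lieDeriv, hXY]

/-- Generators up to a multiple by a function become generators on an open set where the function
does not vanish. -/
theorem top_le_span_restrictGr (hUV : U ≤ V) {l : ℕ} {S : Set (Gr F l)} {g : Fn V}
    (hg : IsUnit (restrictFnHom hUV g)) (hS : ∀ x : Gr F l, g • x ∈ Submodule.span (Fn V) S) :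
    ⊤ ≤ Submodule.span (Fn U) (restrictGr hUV F l '' S) := by
  refine (span_range_restrictGr hUV F l).trans (Submodule.span_le.2 ?_)
  rintro _ ⟨x, rfl⟩
  have h1 : ∀ y ∈ Submodule.span (Fn V) S,
      restrictGr hUV F l y ∈ Submodule.span (Fn U) (restrictGr hUV F l '' S) := by
    intro y hy
    induction hy using Submodule.span_induction with
    | mem y hy => exact Submodule.subset_span ⟨y, hy, rfl⟩
    | zero => rw [map_zero]; exact Submodule.zero_mem _
    | add y z _ _ h1 h2 => rw [map_add]; exact Submodule.add_mem _ h1 h2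
    | smul a y _ h => rw [LinearMap.map_smulₛₗ]; exact Submodule.smul_mem _ _ h
  have h2 := h1 _ (hS x)
  rw [LinearMap.map_smulₛₗ] at h2
  obtain ⟨u, hu⟩ := hg
  rw [← hu] at h2
  have h3 := Submodule.smul_mem _ ((u⁻¹ : (Fn U)ˣ) : Fn U) h2
  rwa [smul_smul, Units.inv_mul, one_smul] at h3

end Filtration

/-! ### Involutive lifts -/

section Involutive

variable {Ω : Submodule (Fn V) (Form V)} {F : ℕ → Submodule (Fn V) (Form V)}

/-- Quasiregularity of all sufficiently high components of the graded module of a filtration gives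
involutive lifts. The lowest component of the graded module of a lift is not a component of the
original graded module, and quasiregularity does not concern it. -/
theorem isInvolutive_lift (hF : IsGoodFiltration Ω F) {l₀ L : ℕ}
    (hL : ∀ l, L ≤ l → F l ⊔ lieSpan (orth Ω) (F l) = F (l + 1)) {n : ℕ} (X : ℕ → orth Ω)
    (B : Module.Basis (Fin n) (Fn V) (orth Ω)) (hB : ∀ j : Fin n, B j = X j)
    (hq : ∀ k, l₀ ≤ k → ∀ i < n, ∀ x : Gr F (k + 1),
      mult hF (X i) (k + 1) x ∈ imageSum (fun j => mult hF (X j)) i (k + 1) →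
        x ∈ imageSum (fun j => mult hF (X j)) i k)
    {c : ℕ} (hc₀ : l₀ ≤ c) (hcL : L ≤ c) : IsInvolutive (hF.lift c) := by
  refine ⟨⟨n, B, fun i l hl => ?_⟩, fun l => ?_⟩
  · obtain ⟨m, rfl⟩ := Nat.exists_eq_add_of_le' hl
    have hBX : (B : Fin n → orth Ω) = fun j : Fin n => X j := funext hB
    have hidx : lift F c (m + 1) = F (m + c + 1) := congrArg F (Nat.add_right_comm m 1 c)
    rw [injective_iff_map_eq_zero]
    intro y hy
    obtain ⟨x, rfl⟩ := Submodule.Quotient.mk_surjective _ y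
    obtain ⟨ω, rfl⟩ := grMk_surjective _ _ x
    rw [Submodule.Quotient.mk_eq_zero]
    have h1 : mult (hF.lift c) (B i) (m + 1) (grMk (lift F c) (m + 1) ω) ∈
        idealPart (hF.lift c) B i (m + 1 + 1) := (Submodule.Quotient.mk_eq_zero _).1 hy
    rw [hBX, idealPart_succ _ X i.2.le] at h1 ⊢
    rw [mult_grMk, grMk_mem_imageSum_iff] at h1
    rw [grMk_mem_imageSum_iff]
    have h2 := hq (m + c) (by omega) i i.2 (grMk F (m + c + 1) ⟨ω, hidx ▸ ω.2⟩)
    rw [mult_grMk, grMk_mem_imageSum_iff, grMk_mem_imageSum_iff] at h2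
    obtain ⟨ξ, hξ, hξ'⟩ := h1
    exact h2 ⟨ξ, fun j => hidx.le (hξ j), hidx.le hξ'⟩
  · have h := hL (l + c) (by omega)
    rwa [Nat.add_right_comm] at h

end Involutive

end Diffiety

open Diffiety

theorem theoremt4p3 {ι : Type*} (M : TopologicalSpace.Opens (ι → ℝ))
    (Ω : Submodule (Diffiety.Fn M) (Diffiety.Form M)) (hΩ : Diffiety.IsDiffiety Ω)
    (F : ℕ → Submodule (Diffiety.Fn M) (Diffiety.Form M)) (hF : Diffiety.IsGoodFiltration Ω F)
    (hfree : ∀ l, Module.Free (Diffiety.Fn M) (Diffiety.Gr F l))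
    (P : ι → ℝ) (hP : P ∈ M) :
    ∃ (U : TopologicalSpace.Opens (ι → ℝ)) (hU : U ≤ M), P ∈ U ∧
      ∃ c₀ : ℕ, ∀ c, c₀ ≤ c →
        ∃ h : Diffiety.IsGoodFiltration (Diffiety.restrict hU Ω)
            (Diffiety.lift (fun l => Diffiety.restrict hU (F l)) c),
          Diffiety.IsInvolutive h := by
  obtain ⟨n, φ, Z, hZ⟩ := exists_isFrame hΩ.finite_codim hΩ.free_codim
  obtain ⟨L, hL⟩ := hF.eventually_eq
  let X : Fin n → orth Ω := fun k => ⟨Z k, hZ.mem_orth k⟩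
  have hX : ⊤ ≤ Submodule.span (Fn M) (Set.range X) := by
    rintro ⟨Y, hY⟩ -
    have h1 : (⟨Y, hY⟩ : orth Ω) = ∑ k, pairing Y (φ k) • X k := by
      refine Subtype.ext ?_
      rw [Submodule.coe_sum]
      exact hZ.eq_sum hY
    rw [h1]
    exact Submodule.sum_mem _ fun k _ => Submodule.smul_mem _ _ (Submodule.subset_span ⟨k, rfl⟩)
  have hfin : ∀ l, Module.Finite (Fn M) (Gr F l) := fun l => by
    have := hF.finite l
    infer_instance
  -- generic constant combinations of the frame, chosen at the point `P`
  obtain ⟨v, hv, l₀, hl₀, A, e, g, hg, hspan, hcard⟩ := exists_classedType_of_residue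
    (evalAt ⟨P, hP⟩) (constFn M) (evalAt_constFn ⟨P, hP⟩) (T := fun k l => mult hF (X k) l)
    (fun i j l x => mult_comm hF (X i) (X j) l x)
    (fun l hl => iSup_range_mult_eq_top hF hX (hL l hl))
  let U := nonvanishing g
  have hU : U ≤ M := fun x hx => hx.1
  have hPU : P ∈ U := ⟨hP, by rw [hg]; exact one_ne_zero⟩
  have hgU : IsUnit (restrictFnHom hU g) := isUnit_of_ne_zero fun x => x.2.2
  have : Nontrivial (Fn U) := (evalAt (⟨P, hPU⟩ : U)).domain_nontrivial
  have hG := hF.restrict hU hZ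
  have hZU := hZ.restrict hU
  obtain ⟨B, hB⟩ := hZU.exists_basis hv
  let W : ℕ → orth Ω := fun j => ⟨∑ k, constFn M (v j k) • Z k,
    Submodule.sum_mem _ fun k _ => Submodule.smul_mem _ _ (hZ.mem_orth k)⟩
  let Y : ℕ → orth (restrict hU Ω) := fun j =>
    ⟨restrictVField hU (W j), restrictVField_mem_orth hU (W j).2⟩
  have hBY : ∀ j : Fin n, B j = Y j := by
    intro j
    refine Subtype.ext ((hB j).trans ?_)
    funext i
    change _ = restrictFnHom hU ((∑ k, constFn M (v j k) • Z k) i)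
    rw [Finset.sum_apply, Finset.sum_apply, map_sum]
    exact Finset.sum_congr rfl fun k _ => 
      ((restrictFnHom hU).map_mul (constFn M (v j k)) (Z k i)).symm
  have hBspan : ⊤ ≤ Submodule.span (Fn U) (Set.range fun j : Fin n => Y j) := by
    have h1 : (fun j : Fin n => Y j) = B := funext fun j => (hBY j).symm
    rw [h1, B.span_eq]
  have hLG : ∀ l, L ≤ l → restrict hU (F l) ⊔ lieSpan (orth (restrict hU Ω)) (restrict hU (F l)) =
      restrict hU (F (l + 1)) := by
    intro l hl
    refine le_antisymm (sup_le (hG.mono l) (hG.lie_le l)) ?_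
    rw [← hL l hl, restrict_sup]
    exact sup_le_sup_left (restrict_lieSpan_le hU _) _
  have hWcomb : ∀ j l, mult hF (W j) l =
      comb (fun k l => mult hF (X k) l) (fun k => constFn M (v j k)) l := fun j l =>
    mult_sum_smul hF _ X (W j) rfl l
  have hq : ∀ k, l₀ ≤ k → ∀ i < n, ∀ x : Gr (fun l => restrict hU (F l)) (k + 1),
      mult hG (Y i) (k + 1) x ∈ imageSum (fun j => mult hG (Y j)) i (k + 1) →
        x ∈ imageSum (fun j => mult hG (Y j)) i k := by
    intro k hk i _ x hx
    have hfinU : ∀ l, Module.Finite (Fn U) (Gr (fun l => restrict hU (F l)) l) := fun l => by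
      have := hG.finite l
      infer_instance
    refine mem_imageSum_of_card_eq_finrank (T := fun j => mult hG (Y j)) (n := n) (X := A)
      (e := fun b => restrictGr hU F l₀ (e b)) (fun i j l x => mult_comm hG (Y i) (Y j) l x)
      (fun l hl => ?_) ?_ (fun m => ?_) hk hx
    · rw [← iSup_range_mult_eq_top hG hBspan (hLG l (hl₀.trans hl))]
      refine le_antisymm (imageSum_le_iff.2 fun j hj x => ?_) (iSup_le fun j => ?_)
      · exact Submodule.mem_iSup_of_mem (⟨j, hj⟩ : Fin n) (LinearMap.mem_range_self _ x)
      · rintro _ ⟨x, rfl⟩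
        exact apply_mem_imageSum (T := fun j => mult hG (Y j)) j.2 x
    · refine (top_le_span_restrictGr hU hgU hspan).trans (Submodule.span_mono ?_)
      rintro _ ⟨_, ⟨p, rfl⟩, rfl⟩
      refine ⟨p, ?_⟩
      change mult hG (Y p.2) l₀ (restrictGr hU F l₀ (e p.1)) =
        restrictGr hU F (l₀ + 1) (comb (fun k l => mult hF (X k) l)
          (fun k => constFn M (v p.2 k)) l₀ (e p.1))
      rw [← hWcomb]
      exact (restrictGr_mult hF hU hG (W p.2) (Y p.2) rfl l₀ (e p.1)).symm
    · rw [hcard m, finrank_gr_restrict hF hU]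
  exact ⟨U, hU, hPU, max l₀ L, fun c hc => ⟨hG.lift c,
    isInvolutive_lift hG hLG Y B hBY hq (le_of_max_le_left hc) (le_of_max_le_right hc)⟩⟩
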